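/- Let $H$ be a separable real Hilbert space, $T\ge 2$, $\beta_1,\dots,\beta_T\in(0,1)$, $\bar\alpha_t=\prod_{i=1}^t(1-\beta_i)$, $\tilde\beta_t=\frac{1-\bar\alpha_{t-1}}{1-\bar\alpha_t}\beta_t$, let $A:H\to H$ be a bounded linear (smoothing) operator and $C$ the covariance operator of a Gaussian measure $\mathcal N(0,C)$ on $H$. Let $(u_0,e)$ be a random element of $H\times\mathcal E$ (data and condition, $\mathcal E$ a measurable space such as $\mathbb R^d$ or $H$), let $\xi_1,\xi_2,\dots\sim\mathcal N(0,C)$ be independent and independent of $(u_0,e)$, and let the forward process be started at the smoothed input $Au_0$, with $u_t=\sqrt{1-\beta_t}\,u_{t-1}+\sqrt{\beta_t}\,A\xi_t$ for $t\ge 1$ (for $t=1$ the predecessor is $Au_0$), so that $u_t\mid u_0\sim\mathcal N(\sqrt{\bar\alpha_t}Au_0,(1-\bar\alpha_t)ACA^*)$. The forward posteriors are taken to be $\mathbb Q(u_{t-1}|u_t,u_0)=\mathcal N(\tilde m_t(u_t,u_0),\tilde\beta_tC)$ with $$\tilde m_t(u_t,u_0)=\tfrac{\sqrt{\bar\alpha_{t-1}}\beta_t}{1-\bar\alpha_t}Au_0+\tfrac{\sqrt{1-\beta_t}(1-\bar\alpha_{t-1})}{1-\bar\alpha_t}u_t,$$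 and the model, with parameter $\theta\in\Theta$ and measurable noise predictors $\xi_\theta(\cdot,\cdot,t):H\times\mathcal E\to H$, has reverse transitions $\mathbb P_\theta(u_{t-1}|u_t,e)=\mathcal N(m_\theta(u_t,e,t),\tilde\beta_tC)$ for $2\le t\le T$, where for $1\le t\le T$ $m_\theta(u,e,t)=\frac1{\sqrt{1-\beta_t}}\bigl(u-\frac{\beta_t}{\sqrt{1-\bar\alpha_t}}\xi_\theta(u,e,t)\bigr)$, a parameter-free law $\mathbb P(u_T)$, and a decoder $\mathbb P_\theta(u_0|u_1,e)$ with a density with respect to a reference measure. Here $B^{-1/2}$ is the (pseudo-)inverse of $B^{1/2}$ on $B^{1/2}(H)$, and $\|B^{-1/2}x\|^2=\infty$ for $x\notin B^{1/2}(H)$. The variational bound is $$\mathcal L(\theta)=\mathbb E\Bigl[L_T+L_0(\theta)+\sum_{t=2}^TL_{t-1}(\theta)\Bigr],$$ $L_T=\mathrm{KL}(\mathbb Q(u_T|u_0)\,\|\,\mathbb P(u_T))$, $L_0(\theta)=-\log\mathbb P_\theta(u_0|u_1,e)$, $L_{t-1}(\theta)=\mathrm{KL}(\mathbb Q(u_{t-1}|u_t,u_0)\,\|\,\mathbb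 P_\theta(u_{t-1}|u_t,e))$, the expectation being understood as $\mathbb E[L_T+\sum_{t=2}^TL_{t-1}(\theta)]+\mathbb E\,L_0(\theta)$ with $\mathbb E\,L_0=\mathbb E\,L_0^+-\mathbb E\,L_0^-$ (and $\infty-\infty:=-\infty$). (1) For $1\le t\le T$ and all $\theta,u_t,u_0,e$: if $\tilde m_t(u_t,u_0)-m_\theta(u_t,e,t)\in(\tilde\beta_tC)^{1/2}(H)$, then $$\mathrm{KL}\bigl(\mathcal N(\tilde m_t,\tilde\beta_tC)\,\|\,\mathcal N(m_\theta,\tilde\beta_tC)\bigr)=\tfrac12\bigl\|(\tilde\beta_tC)^{-1/2}(\tilde m_t-m_\theta)\bigr\|^2 .$$ (2) For every $\theta$ and $2\le t\le T$, with $\lambda_t=\frac{\beta_t^2}{2\tilde\beta_t(1-\beta_t)(1-\bar\alpha_t)}$ and $\xi\sim\mathcal N(0,C)$ independent of $(u_0,e)$, $$\mathbb E\,L_{t-1}(\theta)=\lambda_t\,\mathbb E\bigl\|C^{-1/2}\bigl(A\xi-\xi_\theta(\sqrt{\bar\alpha_t}Au_0+\sqrt{1-\bar\alpha_t}A\xi,e,t)\bigr)\bigr\|^2$$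 (in $[0,\infty]$). Hence $\mathcal L(\theta)=\mathbb E\,L_T+\mathbb E\,L_0(\theta)+(T-1)\,\ell(\theta)$, where $$\ell(\theta)=\mathbb E\,\lambda_t\bigl\|C^{-1/2}\bigl(A\xi-\xi_\theta(\sqrt{\bar\alpha_t}Au_0+\sqrt{1-\bar\alpha_t}A\xi,e,t)\bigr)\bigr\|^2$$ with $t$ uniform on $\{2,\dots,T\}$ and independent of $(u_0,e,\xi)$. (3) Assume $\mathbb E\,L_T<\infty$. Then $\mathcal L$ and $\mathbb E\,L_0+(T-1)\ell$ have the same minimizers over $\Theta$. If moreover $\mathbb E\,L_0(\theta)$ is finite and does not depend on $\theta$ (a decoder without trained parameters), then $$\operatorname*{argmin}_{\theta\in\Theta}\mathcal L(\theta)=\operatorname*{argmin}_{\theta\in\Theta}\ell(\theta).$$ -/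

import Mathlib

open MeasureTheory ProbabilityTheory InformationTheory
open scoped ENNReal

namespace FunDiff

noncomputable section

section Gaussian

variable {H : Type*} [NormedAddCommGroup H] [InnerProductSpace ℝ H]

/-- `μ` is a Gaussian measure on `H` with mean element `m` and covariance operator `C`. -/
structure IsGaussianMeasure [MeasurableSpace H] (μ : Measure H) (m : H) (C : H →L[ℝ] H) :
    Prop where
  isGaussian : IsGaussian μ
  mean : ∀ u : H, ∫ x, inner ℝ u x ∂μ = inner ℝ m u
  cov : ∀ u₁ u₂ : H, ∫ x, inner ℝ u₁ (x - m) * inner ℝ u₂ (x - m) ∂μ = inner ℝ (C u₁) u₂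

open Classical in
/-- The Gaussian measure `N(m, C)`. On a separable Hilbert space it exists exactly when `C` is a
covariance operator (symmetric, positive semi-definite, trace class), and it is then unique.
When there is no such measure the value is the zero measure. -/
def gaussianMeasure [MeasurableSpace H] (m : H) (C : H →L[ℝ] H) : Measure H :=
  if h : ∃ μ : Measure H, IsGaussianMeasure μ m C then h.choose else 0

open Classical in
/-- The positive square root `C^{1/2}` of a positive operator `C`. -/
def posSqrt (C : H →L[ℝ] H) : H →L[ℝ] H :=
  if h : ∃ S : H →L[ℝ] H, S.IsPositive ∧ S ∘L S = C then h.choose else 0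

/-- The Cameron-Martin space `C^{1/2}(H)` of `N(0, C)`. -/
def cameronMartin (C : H →L[ℝ] H) : Set H := Set.range (posSqrt C)

open Classical in
/-- The (pseudo-)inverse `C^{-1/2}` of `C^{1/2}`: for `x ∈ C^{1/2}(H)`, the unique `y` orthogonal
to the kernel of `C^{1/2}` with `C^{1/2} y = x`. (The value off `C^{1/2}(H)` is irrelevant.) -/
def invSqrt (C : H →L[ℝ] H) (x : H) : H :=
  if h : ∃ y : H, y ∈ (LinearMap.ker (posSqrt C).toLinearMap)ᗮ ∧ posSqrt C y = x
  then h.choose else 0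

open Classical in
/-- `‖C^{-1/2} x‖²`, with the usual convention that it is `∞` off the domain `C^{1/2}(H)` of
`C^{-1/2}`. -/
def invSqrtNormSq (C : H →L[ℝ] H) (x : H) : ℝ≥0∞ :=
  if x ∈ cameronMartin C then ENNReal.ofReal (‖invSqrt C x‖ ^ 2) else ∞

end Gaussian

section Schedule

/-- `ᾱ_t = ∏_{i=1}^t (1 - β_i)`. -/
def alphaBar (β : ℕ → ℝ) (t : ℕ) : ℝ := ∏ i ∈ Finset.Icc 1 t, (1 - β i)

/-- `β̃_t = (1 - ᾱ_{t-1}) / (1 - ᾱ_t) * β_t`, used for `t ≥ 1`. -/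
def betaTilde (β : ℕ → ℝ) (t : ℕ) : ℝ :=
  (1 - alphaBar β (t - 1)) / (1 - alphaBar β t) * β t

/-- `λ_t = β_t² / (2 β̃_t (1 - β_t) (1 - ᾱ_t))`, used for `t ≥ 2` (note that `β̃_1 = 0`). -/
def lossWeight (β : ℕ → ℝ) (t : ℕ) : ℝ :=
  β t ^ 2 / (2 * betaTilde β t * (1 - β t) * (1 - alphaBar β t))

end Schedule

section Model

variable {H : Type*} [NormedAddCommGroup H] [InnerProductSpace ℝ H]

/-- The forward chain driven by the smoothed noises `A ξ_t`, started at the smoothed input `A u₀`: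
`u_t = √(1 - β_t) u_{t-1} + √β_t A ξ_t`. -/
def forward (A : H →L[ℝ] H) (β : ℕ → ℝ) (u₀ : H) (ξ : ℕ → H) : ℕ → H
  | 0 => A u₀
  | t + 1 => √(1 - β (t + 1)) • forward A β u₀ ξ t + √(β (t + 1)) • A (ξ (t + 1))

/-- The mean `m̃_t(u_t, u₀)` of the forward posterior `Q(u_{t-1} | u_t, u₀)`. -/
def posteriorMean (A : H →L[ℝ] H) (β : ℕ → ℝ) (t : ℕ) (ut u₀ : H) : H :=
  (√(alphaBar β (t - 1)) * β t / (1 - alphaBar β t)) • A u₀ +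
    (√(1 - β t) * (1 - alphaBar β (t - 1)) / (1 - alphaBar β t)) • ut

/-- The mean `m_θ(u_t, e, t)` of the reverse transition, obtained from the value `z = ξ_θ(u_t, e, t)`
of the noise predictor. -/
def modelMean (β : ℕ → ℝ) (t : ℕ) (ut z : H) : H :=
  (1 / √(1 - β t)) • (ut - (β t / √(1 - alphaBar β t)) • z)

variable [MeasurableSpace H] {E Θ : Type*}

/-- The forward posterior `Q(u_{t-1} | u_t, u₀) = N(m̃_t(u_t, u₀), β̃_t C)`. -/
def posterior (A C : H →L[ℝ] H) (β : ℕ → ℝ) (t : ℕ) (ut u₀ : H) : Measure H :=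
  gaussianMeasure (posteriorMean A β t ut u₀) (betaTilde β t • C)

/-- The reverse transition `P_θ(u_{t-1} | u_t, e) = N(m_θ(u_t, e, t), β̃_t C)`. -/
def reverse (C : H →L[ℝ] H) (β : ℕ → ℝ) (ξθ : Θ → H → E → ℕ → H) (θ : Θ) (t : ℕ) (ut : H)
    (e : E) : Measure H :=
  gaussianMeasure (modelMean β t ut (ξθ θ ut e t)) (betaTilde β t • C)

/-- `L_{t-1} = KL(Q(u_{t-1} | u_t, u₀) ‖ P_θ(u_{t-1} | u_t, e))`. -/
def klStep (A C : H →L[ℝ] H) (β : ℕ → ℝ) (ξθ : Θ → H → E → ℕ → H) (θ : Θ) (t : ℕ) (ut u₀ : H)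
    (e : E) : ℝ≥0∞ :=
  klDiv (posterior A C β t ut u₀) (reverse C β ξθ θ t ut e)

/-- `L_T = KL(Q(u_T | u₀) ‖ P(u_T))`, where `Q(u_T | u₀) = N(√ᾱ_T A u₀, (1 - ᾱ_T) A C A*)` and
`P(u_T) = prior`. -/
def klPrior [CompleteSpace H] (A C : H →L[ℝ] H) (β : ℕ → ℝ) (T : ℕ) (prior : Measure H)
    (u₀ : H) : ℝ≥0∞ :=
  klDiv (gaussianMeasure (√(alphaBar β T) • A u₀)
    ((1 - alphaBar β T) • (A ∘L C ∘L ContinuousLinearMap.adjoint A))) prior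

/-- `L_0 = -log P_θ(u₀ | u₁, e)`, the likelihood being the density of the last reverse transition
(the decoder) with respect to a reference measure `ν`. -/
def decoderNLL (dec : Θ → H → E → Measure H) (ν : Measure H) (θ : Θ) (u₀ u₁ : H) (e : E) : EReal :=
  -ENNReal.log ((dec θ u₁ e).rnDeriv ν u₀)

/-- Expectation of an extended-real random variable, positive part minus negative part. -/
def eexpect {Ω : Type*} [MeasurableSpace Ω] (P : Measure Ω) (f : Ω → EReal) : EReal :=
  ((∫⁻ ω, (f ω).toENNReal ∂P : ℝ≥0∞) : EReal) - ((∫⁻ ω, (-f ω).toENNReal ∂P : ℝ≥0∞) : EReal)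

/-- `E_Q L_0` for the forward chain with input `u₀`, condition `e` and noises `ξ`. -/
def expectedNLL {Ω : Type*} [MeasurableSpace Ω] (P : Measure Ω) (A : H →L[ℝ] H) (β : ℕ → ℝ)
    (dec : Θ → H → E → Measure H) (ν : Measure H)
    (u₀ : Ω → H) (e : Ω → E) (ξ : ℕ → Ω → H) (θ : Θ) : EReal :=
  eexpect P fun ω ↦
    decoderNLL dec ν θ (u₀ ω) (forward A β (u₀ ω) (fun s ↦ ξ s ω) 1) (e ω)

/-- The variational upper bound `E_Q [L_T + L_0 + ∑_{t=2}^T L_{t-1}]` as a function of `θ`; the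
only term that may be negative, `L_0`, is integrated separately. -/
def learningObjective [CompleteSpace H] {Ω : Type*} [MeasurableSpace Ω] (P : Measure Ω)
    (A C : H →L[ℝ] H) (β : ℕ → ℝ) (T : ℕ) (prior : Measure H)
    (dec : Θ → H → E → Measure H) (ν : Measure H) (ξθ : Θ → H → E → ℕ → H)
    (u₀ : Ω → H) (e : Ω → E) (ξ : ℕ → Ω → H) (θ : Θ) : EReal :=
  ((∫⁻ ω, (klPrior A C β T prior (u₀ ω) + ∑ t ∈ Finset.Icc 2 T,
      klStep A C β ξθ θ t (forward A β (u₀ ω) (fun s ↦ ξ s ω) t) (u₀ ω) (e ω)) ∂P : ℝ≥0∞) : EReal)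
    + expectedNLL P A β dec ν u₀ e ξ θ

/-- The expected noise-prediction error at step `t`,
`E ‖C^{-1/2} (A ξ - ξ_θ(√ᾱ_t A u₀ + √(1 - ᾱ_t) A ξ, e, t))‖²`, with `(u₀, e) ∼ D` and
`ξ ∼ N(0, C)` independent. -/
def noiseError [MeasurableSpace E] (D : Measure (H × E)) (A C : H →L[ℝ] H) (β : ℕ → ℝ)
    (ξθ : Θ → H → E → ℕ → H) (θ : Θ) (t : ℕ) : ℝ≥0∞ :=
  ∫⁻ z, ∫⁻ x, invSqrtNormSq C
    (A x - ξθ θ (√(alphaBar β t) • A z.1 + √(1 - alphaBar β t) • A x) z.2 t)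
    ∂(gaussianMeasure 0 C) ∂D

/-- The weighted noise-prediction loss `E λ_t ‖C^{-1/2} (A ξ - ξ_θ(…))‖²`, with `t` uniform on
`{2, …, T}`. -/
def noiseLoss [MeasurableSpace E] (D : Measure (H × E)) (A C : H →L[ℝ] H) (β : ℕ → ℝ) (T : ℕ)
    (ξθ : Θ → H → E → ℕ → H) (θ : Θ) : ℝ≥0∞ :=
  ((Finset.Icc 2 T).card : ℝ≥0∞)⁻¹ *
    ∑ t ∈ Finset.Icc 2 T, ENNReal.ofReal (lossWeight β t) * noiseError D A C β ξθ θ t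

/-- The set of global minimizers. -/
def argmin {α : Type*} [Preorder α] (f : Θ → α) : Set Θ := {θ | ∀ θ', f θ ≤ f θ'}

end Model

end

end FunDiff

open FunDiff

/-! Everything rests on one identity, valid in `[0, ∞]`: two Gaussian measures with common
covariance `C` and means `m'`, `m` have divergence `½ ‖C^{-1/2}(m' - m)‖²`, infinite off the
Cameron-Martin space (`klDiv_eq_invSqrtNormSq`). The link is the formula `‖C^{-1/2} x‖² = sup_u
(2⟪x, u⟫ - ⟪C u, u⟫)` (`invSqrtNormSq_eq_iSup`).

Lower bound: the Donsker-Varadhan inequality with test function `⟪u, ·⟫` gives each term of the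
supremum. Upper bound: write `m' - m = C^{1/2} y` and approximate `y` by `C^{1/2} u_n`. Shifts by `C
u_n` have explicit exponential densities of entropy `½ ⟪C u_n, u_n⟫`. These converge in `L²`, the
limit is the density of `N(m', C)` because its exponential moments are right, and Fatou bounds its
entropy.

For diffusion, unrolling the chain gives `u_t = √ᾱ_t A u₀ + √(1 - ᾱ_t) A ζ` with `ζ ∼ N(0, C)`
independent of the data. The posterior mean then has the form of the model mean with `A ζ` in place
of the predicted noise, so the difference of means is a multiple of the prediction error and the
scaling produces `λ_t`. Tonelli yields the expectations, and minimizers are unchanged because finite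
constants cancel and `T - 1` is positive and finite. -/

namespace FunDiff

/-! ### The Catalan power series and the square root of `1 - X` -/

section Sqrt

/-- The coefficients of `2 (1 - √(1 - x)) / x = ∑ (catalan n / 4 ^ n) x ^ n`. -/
noncomputable def catalanCoeff (n : ℕ) : ℝ := catalan n / 4 ^ n

lemma catalanCoeff_nonneg (n : ℕ) : 0 ≤ catalanCoeff n := by
  unfold catalanCoeff; positivity

/-- The sum telescopes: with `b n = centralBinom n / 4 ^ n`, each coefficient is `2 (b n - b (n +
1))`. This gives summability with total at most 2. -/
lemma sum_range_catalanCoeff (N : ℕ) :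
    ∑ n ∈ Finset.range N, catalanCoeff n = 2 * (1 - N.centralBinom / 4 ^ N) := by
  induction N with
  | zero => simp
  | succ N ih =>
    rw [Finset.sum_range_succ, ih, catalanCoeff]
    have h1 : ((N : ℝ) + 1) * (N + 1).centralBinom = 2 * (2 * N + 1) * N.centralBinom := by
      exact_mod_cast Nat.succ_mul_centralBinom_succ N
    have h2 : ((N : ℝ) + 1) * catalan N = N.centralBinom := by
      exact_mod_cast succ_mul_catalan_eq_centralBinom N
    have hN : (N : ℝ) + 1 ≠ 0 := by positivity
    have h3 : ((N + 1).centralBinom : ℝ) = 2 * (2 * N + 1) * catalan N := by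
      apply mul_left_cancel₀ hN
      rw [h1, ← h2]; ring
    rw [h3, ← h2, pow_succ]
    field_simp
    ring

lemma summable_catalanCoeff : Summable catalanCoeff :=
  summable_of_sum_range_le catalanCoeff_nonneg (c := 2) fun N ↦ by
    rw [sum_range_catalanCoeff]
    have : (0 : ℝ) ≤ N.centralBinom / 4 ^ N := by positivity
    linarith

lemma tsum_catalanCoeff_le : ∑' n, catalanCoeff n ≤ 2 :=
  Real.tsum_le_of_sum_range_le catalanCoeff_nonneg fun N ↦ by
    rw [sum_range_catalanCoeff]
    have : (0 : ℝ) ≤ N.centralBinom / 4 ^ N := by positivity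
    linarith

lemma catalanCoeff_succ (n : ℕ) :
    catalanCoeff (n + 1) =
      1 / 4 * ∑ kl ∈ Finset.HasAntidiagonal.antidiagonal n, catalanCoeff kl.1 * catalanCoeff kl.2 := by
  unfold catalanCoeff
  rw [catalan_succ', Nat.cast_sum, Finset.sum_div, Finset.mul_sum]
  refine Finset.sum_congr rfl fun kl hkl ↦ ?_
  rw [← Finset.HasAntidiagonal.mem_antidiagonal.1 hkl, pow_succ, pow_add]
  push_cast
  field_simp

variable {R : Type*} [NormedRing R] [NormedAlgebra ℝ R]

/-- The power series of `2 (1 - √(1 - x)) / x`. -/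
noncomputable def catalanSeries (X : R) : R := ∑' n, catalanCoeff n • X ^ n

lemma norm_catalanCoeff_smul_pow_le {X : R} (hX : ∀ n, ‖X ^ n‖ ≤ 1) (n : ℕ) :
    ‖catalanCoeff n • X ^ n‖ ≤ catalanCoeff n := by
  rw [norm_smul, Real.norm_of_nonneg (catalanCoeff_nonneg n)]
  exact mul_le_of_le_one_right (catalanCoeff_nonneg n) (hX n)

lemma norm_catalanSeries_le {X : R} (hX : ∀ n, ‖X ^ n‖ ≤ 1) : ‖catalanSeries X‖ ≤ 2 :=
  (tsum_of_norm_bounded summable_catalanCoeff.hasSum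
    (norm_catalanCoeff_smul_pow_le hX)).trans tsum_catalanCoeff_le

lemma summable_norm_catalanSeries {X : R} (hX : ∀ n, ‖X ^ n‖ ≤ 1) :
    Summable fun n ↦ ‖catalanCoeff n • X ^ n‖ :=
  Summable.of_nonneg_of_le (fun _ ↦ norm_nonneg _) (norm_catalanCoeff_smul_pow_le hX)
    summable_catalanCoeff

variable [CompleteSpace R]

/-- Segner's recurrence read as a Cauchy product. Absolute summability of the coefficients allows
norm exactly 1, where a geometric bound would fail. -/
lemma catalanSeries_eq {X : R} (hX : ∀ n, ‖X ^ n‖ ≤ 1) :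
    catalanSeries X = 1 + (1 / 4 : ℝ) • (X * (catalanSeries X * catalanSeries X)) := by
  have hs := summable_norm_catalanSeries hX
  have hsq := summable_norm_sum_mul_antidiagonal_of_summable_norm hs hs
  conv_lhs => rw [catalanSeries, hs.of_norm.tsum_eq_zero_add]
  congr 1
  · simp [catalanCoeff]
  · rw [catalanSeries, tsum_mul_tsum_eq_tsum_sum_antidiagonal_of_summable_norm hs hs,
      ← (hsq.of_norm).tsum_mul_left, ← ((hsq.of_norm).mul_left X).tsum_const_smul]
    refine tsum_congr fun n ↦ ?_
    rw [catalanCoeff_succ, mul_smul, Finset.sum_smul, Finset.mul_sum]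
    congr 1
    refine Finset.sum_congr rfl fun kl hkl ↦ ?_
    rw [smul_mul_smul_comm, ← pow_add, Finset.HasAntidiagonal.mem_antidiagonal.1 hkl, mul_smul_comm, pow_succ']

lemma commute_catalanSeries {X : R} (hX : ∀ n, ‖X ^ n‖ ≤ 1) : Commute X (catalanSeries X) := by
  have hs := (summable_norm_catalanSeries hX).of_norm
  rw [Commute, SemiconjBy, catalanSeries, ← hs.tsum_mul_left, ← hs.tsum_mul_right]
  refine tsum_congr fun n ↦ ?_
  rw [mul_smul_comm, smul_mul_assoc, pow_mul_comm']

/-- `(1 - X G / 2)² = 1 - X` for the Catalan series `G` of `X`. -/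
lemma sq_one_sub_catalanSeries {X : R} (hX : ∀ n, ‖X ^ n‖ ≤ 1) :
    (1 - (1 / 2 : ℝ) • (X * catalanSeries X)) * (1 - (1 / 2 : ℝ) • (X * catalanSeries X))
      = 1 - X := by
  have h1 := catalanSeries_eq hX
  have h2 : catalanSeries X * X = X * catalanSeries X := (commute_catalanSeries hX).symm
  set G := catalanSeries X
  -- The functional equation times `X`; it replaces the quadratic term of the expanded square.
  have h3 : (1 / 4 : ℝ) • (X * (X * (G * G))) = X * G - X := by
    have := congrArg (X * ·) h1
    simp only [mul_add, mul_one, mul_smul_comm] at this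
    rw [this]; abel
  have h4 : X * G * (X * G) = X * (X * (G * G)) := by
    rw [mul_assoc, ← mul_assoc G X G, h2]; simp only [mul_assoc]
  rw [sub_mul, mul_sub, one_mul, mul_sub, mul_one, smul_mul_smul_comm, h4]
  have h5 : (1 / 2 * (1 / 2) : ℝ) = 1 / 4 := by norm_num
  rw [h5, h3]
  have h6 : (1 / 2 : ℝ) • (X * G) + (1 / 2 : ℝ) • (X * G) = X * G := by
    rw [← add_smul]; norm_num
  rw [one_mul]
  calc _ = 1 - ((1 / 2 : ℝ) • (X * G) + (1 / 2 : ℝ) • (X * G)) + (X * G - X) := by abel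
    _ = _ := by rw [h6]; abel

end Sqrt

/-! ### Positive square roots and the Cameron-Martin norm -/

section OperatorSqrt

variable {H : Type*} [NormedAddCommGroup H] [InnerProductSpace ℝ H]

open scoped RealInnerProductSpace

/-- Cauchy-Schwarz inequality for a positive operator. -/
lemma inner_sq_le_of_isPositive {C : H →L[ℝ] H} (hC : C.IsPositive) (u v : H) :
    ⟪C u, v⟫ ^ 2 ≤ ⟪C u, u⟫ * ⟪C v, v⟫ := by
  have h : ∀ t : ℝ, 0 ≤ ⟪C v, v⟫ * (t * t) + (2 * ⟪C u, v⟫) * t + ⟪C u, u⟫ := fun t ↦ by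
    have := hC.inner_nonneg_left (u + t • v)
    simp only [map_add, map_smul, inner_add_left, inner_add_right, real_inner_smul_left,
      real_inner_smul_right] at this
    have h' : ⟪C v, u⟫ = ⟪C u, v⟫ := by
      rw [hC.inner_left_eq_inner_right, real_inner_comm]
    rw [h'] at this
    linarith
  have := discrim_le_zero h
  rw [discrim] at this
  linarith

/-- Cauchy-Schwarz for the form of `X` at `u` and `X u` gives `‖X u‖⁴ ≤ ‖u‖² ‖X u‖²`. -/
lemma norm_le_one_of_isPositive {X : H →L[ℝ] H} (hX : X.IsPositive)
    (h : ∀ u, ⟪X u, u⟫ ≤ ‖u‖ ^ 2) : ‖X‖ ≤ 1 := by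
  refine ContinuousLinearMap.opNorm_le_bound _ zero_le_one fun u ↦ ?_
  rw [one_mul]
  have h1 := inner_sq_le_of_isPositive hX u (X u)
  rw [real_inner_self_eq_norm_sq] at h1
  have h2 : ⟪X u, u⟫ * ⟪X (X u), X u⟫ ≤ ‖u‖ ^ 2 * ‖X u‖ ^ 2 :=
    mul_le_mul (h u) (h _) (hX.inner_nonneg_left _) (by positivity)
  rcases eq_or_lt_of_le (norm_nonneg (X u)) with h0 | h0
  · rw [← h0]; positivity
  · refine abs_le_of_sq_le_sq' ?_ (norm_nonneg _) |>.2
    refine le_of_mul_le_mul_right ?_ (pow_pos h0 2)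
    calc ‖X u‖ ^ 2 * ‖X u‖ ^ 2 = (‖X u‖ ^ 2) ^ 2 := by ring
      _ ≤ _ := h1.trans h2

variable [CompleteSpace H]

/-- Every positive operator on a real Hilbert space has a positive square root. -/
theorem exists_isPositive_sqrt {C : H →L[ℝ] H} (hC : C.IsPositive) :
    ∃ S : H →L[ℝ] H, S.IsPositive ∧ S ∘L S = C := by
  -- The `+ 1` keeps `K` positive when `C = 0`. Then `X = 1 - C / K` is a positive contraction and
  -- `C / K = 1 - X` has the root `1 - X G / 2`.
  set K : ℝ := ‖C‖ + 1
  have hK : 0 < K := by positivity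
  set X : H →L[ℝ] H := 1 - K⁻¹ • C with hXdef
  have hCself : IsSelfAdjoint C := hC.isSelfAdjoint
  have hXself : IsSelfAdjoint X := by
    refine (IsSelfAdjoint.one _).sub ?_
    exact IsSelfAdjoint.smul (IsSelfAdjoint.all K⁻¹) hCself
  have hXi : ∀ u, ⟪X u, u⟫ = ‖u‖ ^ 2 - K⁻¹ * ⟪C u, u⟫ := fun u ↦ by
    simp [hXdef, inner_sub_left, real_inner_smul_left]
  have hXpos : X.IsPositive := by
    rw [ContinuousLinearMap.isPositive_iff']
    refine ⟨hXself, fun u ↦ ?_⟩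
    rw [hXi, sub_nonneg, inv_mul_le_iff₀ hK]
    calc ⟪C u, u⟫ ≤ ‖C u‖ * ‖u‖ := real_inner_le_norm _ _
      _ ≤ ‖C‖ * ‖u‖ * ‖u‖ := by gcongr; exact C.le_opNorm u
      _ ≤ K * ‖u‖ ^ 2 := by
        rw [pow_two, ← mul_assoc]
        gcongr
        exact (lt_add_one _).le
  have hXnorm : ‖X‖ ≤ 1 := norm_le_one_of_isPositive hXpos fun u ↦ by
    rw [hXi, sub_le_self_iff]
    exact mul_nonneg (inv_nonneg.2 hK.le) (hC.inner_nonneg_left u)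
  have hXpow : ∀ n, ‖X ^ n‖ ≤ 1 := fun n ↦ by
    induction n with
    | zero => exact ContinuousLinearMap.norm_id_le
    | succ n ih =>
      rw [pow_succ]
      exact (norm_mul_le _ _).trans (mul_le_one₀ ih (norm_nonneg _) hXnorm)
  set G := catalanSeries X
  have hGself : IsSelfAdjoint G := by
    rw [IsSelfAdjoint, ← starL_apply ℝ]
    rw [show G = ∑' n, catalanCoeff n • X ^ n from rfl,
      ContinuousLinearEquiv.map_tsum]
    refine tsum_congr fun n ↦ ?_
    exact IsSelfAdjoint.smul (IsSelfAdjoint.all (catalanCoeff n)) (hXself.pow n)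
  set S₀ : H →L[ℝ] H := 1 - (1 / 2 : ℝ) • (X * G)
  have hS₀ : S₀ * S₀ = 1 - X := sq_one_sub_catalanSeries hXpow
  have hS₀self : IsSelfAdjoint S₀ := by
    refine (IsSelfAdjoint.one _).sub ?_
    refine IsSelfAdjoint.smul (IsSelfAdjoint.all (1 / 2 : ℝ)) ?_
    exact (hXself.commute_iff hGself).1 (commute_catalanSeries hXpow)
  have hS₀pos : S₀.IsPositive := by
    rw [ContinuousLinearMap.isPositive_iff']
    refine ⟨hS₀self, fun u ↦ ?_⟩
    have : ⟪S₀ u, u⟫ = ‖u‖ ^ 2 - 1 / 2 * ⟪(X * G) u, u⟫ := by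
      simp [S₀, inner_sub_left, real_inner_smul_left]
    rw [this]
    -- The bound 2 on the norm of `G` is exactly what positivity of `1 - X G / 2` requires.
    have h1 : ⟪(X * G) u, u⟫ ≤ 2 * ‖u‖ ^ 2 := by
      calc ⟪(X * G) u, u⟫ ≤ ‖(X * G) u‖ * ‖u‖ := real_inner_le_norm _ _
        _ ≤ ‖X * G‖ * ‖u‖ * ‖u‖ := by gcongr; exact (X * G).le_opNorm u
        _ ≤ 2 * ‖u‖ * ‖u‖ := by
          gcongr
          calc ‖X * G‖ ≤ ‖X‖ * ‖G‖ := norm_mul_le _ _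
            _ ≤ 1 * 2 := by gcongr; exact norm_catalanSeries_le hXpow
            _ = 2 := one_mul 2
        _ = _ := by ring
    linarith
  refine ⟨√K • S₀, hS₀pos.smul_of_nonneg (Real.sqrt_nonneg K), ?_⟩
  change (√K • S₀) * (√K • S₀) = C
  rw [smul_mul_smul_comm, Real.mul_self_sqrt hK.le, hS₀, hXdef, sub_sub_cancel, smul_smul,
    mul_inv_cancel₀ hK.ne', one_smul]

lemma posSqrt_isPositive {C : H →L[ℝ] H} (hC : C.IsPositive) : (posSqrt C).IsPositive := by
  rw [posSqrt, dif_pos (exists_isPositive_sqrt hC)]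
  exact (exists_isPositive_sqrt hC).choose_spec.1

lemma posSqrt_comp_posSqrt {C : H →L[ℝ] H} (hC : C.IsPositive) : posSqrt C ∘L posSqrt C = C := by
  rw [posSqrt, dif_pos (exists_isPositive_sqrt hC)]
  exact (exists_isPositive_sqrt hC).choose_spec.2

lemma posSqrt_posSqrt_apply {C : H →L[ℝ] H} (hC : C.IsPositive) (u : H) :
    posSqrt C (posSqrt C u) = C u :=
  DFunLike.congr_fun (posSqrt_comp_posSqrt hC) u

lemma inner_posSqrt {C : H →L[ℝ] H} (hC : C.IsPositive) (u v : H) :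
    ⟪posSqrt C u, v⟫ = ⟪u, posSqrt C v⟫ :=
  (posSqrt_isPositive hC).inner_left_eq_inner_right u v

lemma inner_apply_eq_norm_posSqrt_sq {C : H →L[ℝ] H} (hC : C.IsPositive) (u : H) :
    ⟪C u, u⟫ = ‖posSqrt C u‖ ^ 2 := by
  rw [← posSqrt_posSqrt_apply hC, inner_posSqrt hC, real_inner_self_eq_norm_sq]

/-- `C^{-1/2}` is a right inverse of `C^{1/2}` on the Cameron-Martin space, with values orthogonal
to the kernel. -/
lemma invSqrt_spec {C : H →L[ℝ] H} {x : H} (hx : x ∈ cameronMartin C) :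
    invSqrt C x ∈ (LinearMap.ker (posSqrt C).toLinearMap)ᗮ ∧ posSqrt C (invSqrt C x) = x := by
  have h : ∃ y : H, y ∈ (LinearMap.ker (posSqrt C).toLinearMap)ᗮ ∧ posSqrt C y = x := by
    obtain ⟨z, rfl⟩ := hx
    set K := LinearMap.ker (posSqrt C).toLinearMap
    have : CompleteSpace K := (posSqrt C).isClosed_ker.completeSpace_coe
    refine ⟨z - K.starProjection z, K.sub_starProjection_mem_orthogonal z, ?_⟩
    have : posSqrt C (K.starProjection z) = 0 := K.starProjection_apply_mem z
    rw [map_sub, this, sub_zero]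
  rw [invSqrt, dif_pos h]
  exact h.choose_spec

/-- For a self-adjoint operator the orthogonal complement of the kernel is the closure of the range.
This supplies the approximations `C^{1/2} u_n` used for the supremum and for the densities. -/
lemma invSqrt_mem_closure_range {C : H →L[ℝ] H} (hC : C.IsPositive) {x : H}
    (hx : x ∈ cameronMartin C) : invSqrt C x ∈ closure (Set.range (posSqrt C)) := by
  have h := (invSqrt_spec hx).1
  have h2 := (posSqrt C).orthogonal_ker
  rw [(posSqrt_isPositive hC).isSelfAdjoint.adjoint_eq] at h2
  rw [h2] at h
  exact h

/-- The variational formula `‖C^{-1/2} x‖² = sup_u (2 ⟪x, u⟫ - ⟪C u, u⟫)`. -/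
theorem invSqrtNormSq_eq_iSup {C : H →L[ℝ] H} (hC : C.IsPositive) (x : H) :
    invSqrtNormSq C x = ⨆ u, ENNReal.ofReal (2 * ⟪x, u⟫ - ⟪C u, u⟫) := by
  by_cases hx : x ∈ cameronMartin C
  · rw [invSqrtNormSq, if_pos hx]
    set y := invSqrt C x
    have hy : posSqrt C y = x := (invSqrt_spec hx).2
    -- Completing the square: the supremum is `‖y‖²` because `y` is a limit of vectors `C^{1/2} u`.
    have key : ∀ u, 2 * ⟪x, u⟫ - ⟪C u, u⟫ = ‖y‖ ^ 2 - ‖y - posSqrt C u‖ ^ 2 := fun u ↦ by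
      rw [norm_sub_sq_real, ← inner_posSqrt hC, hy, inner_apply_eq_norm_posSqrt_sq hC]
      ring
    simp_rw [key]
    apply le_antisymm
    · obtain ⟨v, hv, hlim⟩ := mem_closure_iff_seq_limit.1 (invSqrt_mem_closure_range hC hx)
      choose u hu using hv
      refine le_of_tendsto' (f := fun n ↦ ENNReal.ofReal (‖y‖ ^ 2 - ‖y - posSqrt C (u n)‖ ^ 2))
        (x := Filter.atTop) ?_ (fun n ↦ le_iSup (fun u ↦
          ENNReal.ofReal (‖y‖ ^ 2 - ‖y - posSqrt C u‖ ^ 2)) (u n))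
      refine ENNReal.tendsto_ofReal ?_
      simp_rw [hu]
      have : Filter.Tendsto (fun n ↦ ‖y‖ ^ 2 - ‖y - v n‖ ^ 2) Filter.atTop
          (nhds (‖y‖ ^ 2 - ‖y - y‖ ^ 2)) :=
        tendsto_const_nhds.sub ((tendsto_const_nhds.sub hlim).norm.pow 2)
      simpa using this
    · refine iSup_le fun u ↦ ENNReal.ofReal_le_ofReal ?_
      exact sub_le_self _ (by positivity)
  · rw [invSqrtNormSq, if_neg hx]
    by_contra hne
    have hfin : (⨆ u, ENNReal.ofReal (2 * ⟪x, u⟫ - ⟪C u, u⟫)) ≠ ∞ := fun h ↦ hne h.symm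
    set M : ℝ := (⨆ u, ENNReal.ofReal (2 * ⟪x, u⟫ - ⟪C u, u⟫)).toReal
    have hM0 : 0 ≤ M := ENNReal.toReal_nonneg
    have hM : ∀ u, 2 * ⟪x, u⟫ - ⟪C u, u⟫ ≤ M := fun u ↦
      (ENNReal.ofReal_le_iff_le_toReal hfin).1
        (le_iSup (fun u ↦ ENNReal.ofReal (2 * ⟪x, u⟫ - ⟪C u, u⟫)) u)
    -- If the supremum were finite, optimizing over multiples of `u` would bound `⟪x, u⟫` by
    -- `C^{1/2} u`. So `C^{1/2} u ↦ ⟪x, u⟫` would be a bounded functional on the range, and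
    -- Hahn-Banach with Riesz would put `x` in `C^{1/2}(H)`.
    have hsq : ∀ u, |⟪x, u⟫| ≤ √M * ‖posSqrt C u‖ := fun u ↦ by
      have h : ∀ t : ℝ, 0 ≤ ‖posSqrt C u‖ ^ 2 * (t * t) + (-2 * ⟪x, u⟫) * t + M := fun t ↦ by
        have := hM (t • u)
        simp only [map_smul, real_inner_smul_left, real_inner_smul_right,
          inner_apply_eq_norm_posSqrt_sq hC] at this
        linarith
      have h2 := discrim_le_zero h
      rw [discrim] at h2
      refine abs_le_of_sq_le_sq ?_ (by positivity)
      rw [mul_pow, Real.sq_sqrt hM0]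
      linarith
    apply hx
    set S := (posSqrt C).toLinearMap
    -- `g` is merely a linear choice of preimages, with no continuity; `hsq` makes the functional
    -- bounded and independent of the choice.
    obtain ⟨g, hg⟩ := S.rangeRestrict.exists_rightInverse_of_surjective S.range_rangeRestrict
    have hg' : ∀ z, S (g z) = z := fun z ↦ congrArg Subtype.val (DFunLike.congr_fun hg z)
    let f : StrongDual ℝ (LinearMap.range S) :=
      ((innerSL ℝ x).toLinearMap ∘ₗ g).mkContinuous (√M) fun z ↦ by
        have := hsq (g z)
        change |⟪x, g z⟫| ≤ _
        refine this.trans_eq ?_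
        congr 2
        exact hg' z
    obtain ⟨F, hF⟩ := StrongDual.exists_extension (LinearMap.range S) f
    refine ⟨(InnerProductSpace.toDual ℝ H).symm F, ?_⟩
    refine ext_inner_right ℝ fun u ↦ ?_
    rw [inner_posSqrt hC, InnerProductSpace.toDual_symm_apply]
    have h1 : F (posSqrt C u) = ⟪x, g (S.rangeRestrict u)⟫ := (hF (S.rangeRestrict u))
    rw [h1, ← sub_eq_zero, ← inner_sub_right, ← abs_eq_zero]
    refine le_antisymm ((hsq _).trans_eq ?_) (abs_nonneg _)
    have : posSqrt C (g (S.rangeRestrict u)) = posSqrt C u := hg' (S.rangeRestrict u)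
    rw [map_sub, this, sub_self, norm_zero, mul_zero]

/-- Substituting `u = (k / c) v` in the variational formula avoids comparing the chosen roots of `C`
and `c • C`. -/
lemma invSqrtNormSq_smul_smul {C : H →L[ℝ] H} (hC : C.IsPositive) {c k : ℝ} (hc : 0 < c)
    (hk : k ≠ 0) (x : H) :
    invSqrtNormSq (c • C) (k • x) = ENNReal.ofReal (k ^ 2 / c) * invSqrtNormSq C x := by
  rw [invSqrtNormSq_eq_iSup (hC.smul_of_nonneg hc.le), invSqrtNormSq_eq_iSup hC, ENNReal.mul_iSup]
  have hkc : k / c ≠ 0 := div_ne_zero hk hc.ne'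
  refine Function.Surjective.iSup_congr (fun u ↦ (k / c)⁻¹ • u)
    (fun v ↦ ⟨(k / c) • v, by dsimp only; rw [smul_smul, inv_mul_cancel₀ hkc, one_smul]⟩) fun u ↦ ?_
  rw [← ENNReal.ofReal_mul (by positivity)]
  congr 1
  simp only [map_smul, real_inner_smul_left, real_inner_smul_right, smul_apply]
  field_simp

/-- The supremum is uncountable, so measurability goes through lower semicontinuity. -/
lemma measurable_invSqrtNormSq [MeasurableSpace H] [OpensMeasurableSpace H]
    {C : H →L[ℝ] H} (hC : C.IsPositive) : Measurable (invSqrtNormSq C) := by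
  have : invSqrtNormSq C = fun x ↦ ⨆ u, ENNReal.ofReal (2 * ⟪x, u⟫ - ⟪C u, u⟫) :=
    funext fun x ↦ invSqrtNormSq_eq_iSup hC x
  rw [this]
  refine (lowerSemicontinuous_iSup fun u ↦ Continuous.lowerSemicontinuous ?_).measurable
  exact ENNReal.continuous_ofReal.comp (by fun_prop)

end OperatorSqrt

/-! ### Gaussian measures through their one-dimensional marginals -/

section GaussianMeasure

open scoped RealInnerProductSpace

/-- Equal real moment generating functions extend analytically to equal complex ones, here on the
whole plane, and these determine the law. -/
lemma map_eq_gaussianReal_of_mgf_eq {Ω : Type*} [MeasurableSpace Ω] {μ : Measure Ω}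
    [IsFiniteMeasure μ] {X : Ω → ℝ} (hX : AEMeasurable X μ) {m : ℝ} {v : NNReal}
    (h : ∀ t, mgf X μ t = Real.exp (m * t + v * t ^ 2 / 2)) : μ.map X = gaussianReal m v := by
  have h1 : mgf id (gaussianReal m v) = mgf X μ := by
    rw [mgf_id_gaussianReal]; exact (funext h).symm
  have h2 := eqOn_complexMGF_of_mgf h1
  rw [integrableExpSet_id_gaussianReal, interior_univ] at h2
  have := Measure.ext_of_complexMGF_eq hX aemeasurable_id
    (funext fun z ↦ (h2 (Set.mem_univ z.re)).symm)
  simpa using this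

variable {H : Type*} [NormedAddCommGroup H] [InnerProductSpace ℝ H] [MeasurableSpace H]
  {μ ν : Measure H} {m : H} {C : H →L[ℝ] H}

lemma IsGaussianMeasure.isPositive (h : IsGaussianMeasure μ m C) : C.IsPositive := by
  rw [ContinuousLinearMap.isPositive_iff]
  refine ⟨fun u v ↦ ?_, fun u ↦ ?_⟩
  · change ⟪C u, v⟫ = ⟪u, C v⟫
    rw [real_inner_comm, real_inner_comm (C v) u, ← h.cov, real_inner_comm, ← h.cov]
    simp_rw [mul_comm]
  · rw [← h.cov]
    exact integral_nonneg fun x ↦ mul_self_nonneg _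

variable [BorelSpace H]

lemma IsGaussianMeasure.map_inner (h : IsGaussianMeasure μ m C) (u : H) :
    μ.map (fun x ↦ ⟪u, x⟫) = gaussianReal ⟪m, u⟫ ⟪C u, u⟫.toNNReal := by
  have := h.isGaussian
  have h1 := IsGaussian.map_eq_gaussianReal (μ := μ) (innerSL ℝ u)
  have hm : μ[innerSL ℝ u] = ⟪m, u⟫ := h.mean u
  have hv : Var[innerSL ℝ u; μ] = ⟪C u, u⟫ := by
    rw [variance_eq_integral (by fun_prop), hm, ← h.cov]
    refine integral_congr_ae (ae_of_all _ fun x ↦ ?_)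
    simp only [innerSL_apply_apply, inner_sub_right, real_inner_comm m u]
    ring
  rw [hm, hv] at h1
  exact h1

omit [BorelSpace H] in
lemma IsGaussianMeasure.isProbabilityMeasure (h : IsGaussianMeasure μ m C) :
    IsProbabilityMeasure μ := by
  have := h.isGaussian
  infer_instance

lemma IsGaussianMeasure.integrable_inner (h : IsGaussianMeasure μ m C) (u : H) :
    Integrable (fun x ↦ ⟪u, x⟫) μ := by
  have := h.isGaussian
  exact IsGaussian.integrable_dual μ (innerSL ℝ u)

lemma IsGaussianMeasure.integrable_exp_inner (h : IsGaussianMeasure μ m C) (u : H) :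
    Integrable (fun x ↦ Real.exp ⟪u, x⟫) μ := by
  have h1 := integrable_exp_mul_gaussianReal (μ := ⟪m, u⟫) (v := ⟪C u, u⟫.toNNReal) 1
  rw [← h.map_inner u] at h1
  simpa [Function.comp_def] using h1.comp_measurable (by fun_prop)

lemma IsGaussianMeasure.integral_exp_inner (h : IsGaussianMeasure μ m C) (u : H) :
    ∫ x, Real.exp ⟪u, x⟫ ∂μ = Real.exp (⟪m, u⟫ + ⟪C u, u⟫ / 2) := by
  have h1 := mgf_gaussianReal (h.map_inner u) 1
  rw [mgf, Real.coe_toNNReal _ (h.isPositive.inner_nonneg_left u)] at h1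
  simpa using h1

variable [CompleteSpace H]

/-- By Riesz every functional is some `⟪u, ·⟫`; polarization recovers the covariance from the
variances. -/
theorem isGaussianMeasure_of_map_inner (hC : C.IsPositive)
    (h : ∀ u : H, μ.map (fun x ↦ ⟪u, x⟫) = gaussianReal ⟪m, u⟫ ⟪C u, u⟫.toNNReal) :
    IsGaussianMeasure μ m C := by
  have hL : ∀ L : StrongDual ℝ H, ∃ u, L = innerSL ℝ u := fun L ↦
    ⟨(InnerProductSpace.toDual ℝ H).symm L, by
      ext x; rw [innerSL_apply_apply, InnerProductSpace.toDual_symm_apply]⟩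
  have hG : IsGaussian μ := isGaussian_of_map_eq_gaussianReal fun L ↦ by
    obtain ⟨u, rfl⟩ := hL L
    exact ⟨_, _, h u⟩
  have hmean : ∀ u : H, ∫ x, ⟪u, x⟫ ∂μ = ⟪m, u⟫ := fun u ↦ by
    have h1 : ∫ y, y ∂(μ.map (fun x ↦ ⟪u, x⟫)) = ⟪m, u⟫ := by
      rw [h u, integral_id_gaussianReal]
    rwa [integral_map (by fun_prop) (by fun_prop)] at h1
  have hvar : ∀ u : H, ∫ x, ⟪u, x - m⟫ ^ 2 ∂μ = ⟪C u, u⟫ := fun u ↦ by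
    have h1 : Var[fun y ↦ y; μ.map (fun x ↦ ⟪u, x⟫)] = ⟪C u, u⟫ := by
      rw [h u, variance_fun_id_gaussianReal, Real.coe_toNNReal _ (hC.inner_nonneg_left u)]
    rw [variance_map (by fun_prop) (by fun_prop), variance_eq_integral (by fun_prop)] at h1
    rw [← h1]
    simp only [Function.comp_apply, hmean, inner_sub_right, real_inner_comm m u]
  have hint : ∀ u : H, Integrable (fun x ↦ ⟪u, x - m⟫ ^ 2) μ := fun u ↦ by
    have h1 := (IsGaussian.memLp_dual μ (innerSL ℝ u) 2 (by simp)).sub (memLp_const ⟪u, m⟫)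
    have h2 := h1.integrable_sq
    simpa [inner_sub_right] using h2
  refine ⟨hG, hmean, fun u v ↦ ?_⟩
  have h1 : ∀ x : H, ⟪u, x - m⟫ * ⟪v, x - m⟫ =
      (1 / 2) * (⟪u + v, x - m⟫ ^ 2 - ⟪u, x - m⟫ ^ 2 - ⟪v, x - m⟫ ^ 2) := fun x ↦ by
    rw [inner_add_left]; ring
  simp_rw [h1]
  have h3 : Integrable (fun x ↦ ⟪u + v, x - m⟫ ^ 2 - ⟪u, x - m⟫ ^ 2) μ := (hint _).sub (hint _)
  rw [integral_const_mul, integral_sub h3 (hint _),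
    integral_sub (hint _) (hint _), hvar, hvar, hvar]
  have h2 : ⟪C v, u⟫ = ⟪C u, v⟫ := by
    rw [hC.inner_left_eq_inner_right, real_inner_comm]
  simp only [map_add, inner_add_left, inner_add_right, h2]
  ring

theorem isGaussianMeasure_of_integral_exp_inner [IsFiniteMeasure μ] (hC : C.IsPositive)
    (h : ∀ u : H, ∫ x, Real.exp ⟪u, x⟫ ∂μ = Real.exp (⟪m, u⟫ + ⟪C u, u⟫ / 2)) :
    IsGaussianMeasure μ m C := by
  refine isGaussianMeasure_of_map_inner hC fun u ↦
    map_eq_gaussianReal_of_mgf_eq (by fun_prop) fun t ↦ ?_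
  have := h (t • u)
  simp only [map_smul, real_inner_smul_left, real_inner_smul_right] at this
  rw [mgf, this, Real.coe_toNNReal _ (hC.inner_nonneg_left u)]
  ring_nf

/-- A Gaussian measure on a separable Hilbert space is determined by mean and covariance. -/
theorem IsGaussianMeasure.eq [SecondCountableTopology H] (h : IsGaussianMeasure μ m C)
    (h' : IsGaussianMeasure ν m C) : μ = ν := by
  have := h.isProbabilityMeasure
  have := h'.isProbabilityMeasure
  refine Measure.ext_of_charFun (funext fun u ↦ ?_)
  have key : ∀ ρ : Measure H, charFun ρ u = charFun (ρ.map (fun x ↦ ⟪u, x⟫)) 1 := fun ρ ↦ by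
    rw [charFun_apply, charFun_apply, integral_map (by fun_prop) (by fun_prop)]
    simp [real_inner_comm]
  rw [key, key, h.map_inner, h'.map_inner]

lemma IsGaussianMeasure.gaussianMeasure_eq [SecondCountableTopology H]
    (h : IsGaussianMeasure μ m C) : gaussianMeasure m C = μ := by
  have hex : ∃ μ : Measure H, IsGaussianMeasure μ m C := ⟨μ, h⟩
  rw [gaussianMeasure, dif_pos hex]
  exact hex.choose_spec.eq h

omit [BorelSpace H] [CompleteSpace H] in
-- The default value is the zero measure, so being nonzero certifies existence.
lemma isGaussianMeasure_gaussianMeasure_of_neZero [NeZero (gaussianMeasure m C)] :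
    IsGaussianMeasure (gaussianMeasure m C) m C := by
  by_cases h : ∃ μ : Measure H, IsGaussianMeasure μ m C
  · rw [gaussianMeasure, dif_pos h]
    exact h.choose_spec
  · exact absurd (by rw [gaussianMeasure, dif_neg h]) (NeZero.ne (gaussianMeasure m C))

/-- The image of `N(0, C)` under `x ↦ m + a x` is `N(m, a² C)`. -/
lemma IsGaussianMeasure.map_const_add_smul (h : IsGaussianMeasure μ 0 C) (m : H) {a c : ℝ}
    (hc : a ^ 2 = c) : IsGaussianMeasure (μ.map fun x ↦ m + a • x) m (c • C) := by
  have hC := h.isPositive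
  have hc0 : 0 ≤ c := hc ▸ sq_nonneg a
  refine isGaussianMeasure_of_map_inner (hC.smul_of_nonneg hc0) fun u ↦ ?_
  rw [Measure.map_map (by fun_prop) (by fun_prop)]
  have h1 : (fun x : H ↦ ⟪u, x⟫) ∘ (fun x ↦ m + a • x) =
      (fun y ↦ ⟪m, u⟫ + y) ∘ (fun y ↦ a * y) ∘ fun x ↦ ⟪u, x⟫ := by
    ext x; simp [inner_add_right, real_inner_smul_right, real_inner_comm]
  rw [h1, ← Measure.map_map (by fun_prop) (by fun_prop), ← Measure.map_map (by fun_prop)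
    (by fun_prop), h.map_inner, gaussianReal_map_const_mul, gaussianReal_map_const_add]
  congr 1
  · simp
  · ext
    have := hC.inner_nonneg_left u
    have h2 : 0 ≤ c * ⟪C u, u⟫ := mul_nonneg hc0 this
    simp only [smul_apply, real_inner_smul_left, Real.coe_toNNReal _ h2, NNReal.coe_mul,
      Real.coe_toNNReal _ this, NNReal.coe_mk, hc]

/-- Sums of independent Gaussian random elements are Gaussian. -/
lemma isGaussianMeasure_map_add {Ω : Type*} [MeasurableSpace Ω] {P : Measure Ω}
    [SecondCountableTopology H] {X Y : Ω → H} {m₁ m₂ : H} {C₁ C₂ : H →L[ℝ] H}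
    (hXm : AEMeasurable X P) (hYm : AEMeasurable Y P)
    (hX : IsGaussianMeasure (P.map X) m₁ C₁) (hY : IsGaussianMeasure (P.map Y) m₂ C₂)
    (hXY : IndepFun X Y P) :
    IsGaussianMeasure (P.map fun ω ↦ X ω + Y ω) (m₁ + m₂) (C₁ + C₂) := by
  refine isGaussianMeasure_of_map_inner (hX.isPositive.add hY.isPositive) fun u ↦ ?_
  have hXu := hX.map_inner u
  have hYu := hY.map_inner u
  rw [AEMeasurable.map_map_of_aemeasurable (by fun_prop) hXm] at hXu
  rw [AEMeasurable.map_map_of_aemeasurable (by fun_prop) hYm] at hYu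
  have hind : IndepFun ((fun x ↦ ⟪u, x⟫) ∘ X) ((fun x ↦ ⟪u, x⟫) ∘ Y) P :=
    hXY.comp (by fun_prop) (by fun_prop)
  have h1 := gaussianReal_add_gaussianReal_of_indepFun hind hXu hYu
  rw [AEMeasurable.map_map_of_aemeasurable (by fun_prop) (by fun_prop)]
  have h2 : (fun x : H ↦ ⟪u, x⟫) ∘ (fun ω ↦ X ω + Y ω) =
      ((fun x ↦ ⟪u, x⟫) ∘ X) + ((fun x ↦ ⟪u, x⟫) ∘ Y) := by
    ext ω; simp [inner_add_right]
  rw [h2, h1, inner_add_left, add_apply, inner_add_left, Real.toNNReal_add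
    (hX.isPositive.inner_nonneg_left u) (hY.isPositive.inner_nonneg_left u)]

lemma isGaussianMeasure_dirac (m : H) : IsGaussianMeasure (Measure.dirac m) m 0 := by
  refine isGaussianMeasure_of_map_inner ContinuousLinearMap.isPositive_zero fun u ↦ ?_
  have hu : Measurable fun x : H ↦ ⟪u, x⟫ := by fun_prop
  simp [Measure.map_dirac' hu, gaussianReal_zero_var, real_inner_comm]

/-- Linear combinations of independent `N(0, C)` random elements. -/
lemma isGaussianMeasure_map_sum_smul {Ω : Type*} [MeasurableSpace Ω] {P : Measure Ω}
    [IsProbabilityMeasure P] [SecondCountableTopology H] {ξ : ℕ → Ω → H}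
    (hm : ∀ t, AEMeasurable (ξ t) P)
    (hξ : ∀ t, IsGaussianMeasure (P.map (ξ t)) 0 C) (hind : iIndepFun ξ P)
    (c : ℕ → ℝ) (s : Finset ℕ) :
    IsGaussianMeasure (P.map fun ω ↦ ∑ i ∈ s, c i • ξ i ω) 0 ((∑ i ∈ s, c i ^ 2) • C) := by
  have hmc : ∀ i, AEMeasurable (fun ω ↦ c i • ξ i ω) P := fun i ↦ (hm i).const_smul (c i)
  induction s using Finset.cons_induction with
  | empty => simpa using isGaussianMeasure_dirac (0 : H)
  | cons a s ha ih =>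
    simp_rw [Finset.sum_cons, add_smul]
    rw [← add_zero (0 : H)]
    refine isGaussianMeasure_map_add (hmc a)
      (Finset.aemeasurable_fun_sum s fun i _ ↦ hmc i) ?_ ih ?_
    · have h1 := (hξ a).map_const_add_smul 0 (a := c a) rfl
      rw [AEMeasurable.map_map_of_aemeasurable (by fun_prop) (hm a)] at h1
      simpa [Function.comp_def] using h1
    · have hind' : iIndepFun (fun i ω ↦ c i • ξ i ω) P :=
        hind.comp (fun i x ↦ c i • x) fun i ↦ by fun_prop
      have := (hind'.indepFun_finsetSum_of_notMem₀ hmc ha).symm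
      convert! this using 1
      ext ω; simp

end GaussianMeasure

/-! ### Relative entropy of Gaussian measures with equal covariance -/

open Filter Topology
open scoped RealInnerProductSpace

/-- The easy half of the Donsker-Varadhan formula. -/
lemma ofReal_integral_sub_log_le_klDiv {α : Type*} [MeasurableSpace α] {μ ν : Measure α}
    [IsProbabilityMeasure μ] [IsProbabilityMeasure ν] {f : α → ℝ} (hf : Integrable f μ)
    (hexp : Integrable (fun x ↦ Real.exp (f x)) ν) :
    ENNReal.ofReal (∫ x, f x ∂μ - Real.log (∫ x, Real.exp (f x) ∂ν)) ≤ klDiv μ ν := by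
  by_cases h : klDiv μ ν = ∞
  · rw [h]; exact le_top
  obtain ⟨hac, hint⟩ := klDiv_ne_top_iff.1 h
  rw [klDiv_of_ac_of_integrable hac hint]
  refine ENNReal.ofReal_le_ofReal ?_
  -- The inequality is nonnegativity of the divergence of `μ` from `ν` tilted by `f`.
  have := isProbabilityMeasure_tilted hexp
  have h1 := integral_llr_add_sub_measure_univ_nonneg
    (hac.trans (absolutelyContinuous_tilted hexp)) (integrable_llr_tilted_right hac hf hint hexp)
  rw [integral_llr_tilted_right hac hf hexp hint] at h1
  simp only [probReal_univ] at h1 ⊢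
  linarith

section CameronMartin

variable {H : Type*} [NormedAddCommGroup H] [InnerProductSpace ℝ H] [CompleteSpace H]
  [MeasurableSpace H] [BorelSpace H] {μ ν : Measure H} {m m' : H} {C : H →L[ℝ] H}

/-- The Cameron-Martin density of `N(m + C u, C)` with respect to `N(m, C)`. -/
noncomputable def cmDensity (m : H) (C : H →L[ℝ] H) (u x : H) : ℝ :=
  Real.exp (⟪u, x⟫ - ⟪m, u⟫ - ⟪C u, u⟫ / 2)

omit [CompleteSpace H] in
@[fun_prop]
lemma measurable_cmDensity (u : H) : Measurable (cmDensity m C u) := by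
  unfold cmDensity; fun_prop

omit [CompleteSpace H] [MeasurableSpace H] [BorelSpace H] in
lemma cmDensity_pos (u x : H) : 0 < cmDensity m C u x := Real.exp_pos _

omit [CompleteSpace H] [MeasurableSpace H] [BorelSpace H] in
lemma cmDensity_mul_exp (u v x : H) (c : ℝ) :
    cmDensity m C u x * Real.exp (⟪v, x⟫ + c) =
      Real.exp ⟪u + v, x⟫ * Real.exp (c - ⟪m, u⟫ - ⟪C u, u⟫ / 2) := by
  rw [cmDensity, ← Real.exp_add, ← Real.exp_add, inner_add_left]
  ring_nf

omit [CompleteSpace H] in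
lemma integrable_cmDensity_mul_exp (h : IsGaussianMeasure ν m C) (u v : H) (c : ℝ) :
    Integrable (fun x ↦ cmDensity m C u x * Real.exp (⟪v, x⟫ + c)) ν := by
  simp_rw [cmDensity_mul_exp]
  exact (h.integrable_exp_inner _).mul_const _

omit [CompleteSpace H] in
lemma integral_cmDensity_mul_exp (h : IsGaussianMeasure ν m C) (u v : H) (c : ℝ) :
    ∫ x, cmDensity m C u x * Real.exp (⟪v, x⟫ + c) ∂ν =
      Real.exp (⟪m + C u, v⟫ + ⟪C v, v⟫ / 2 + c) := by
  simp_rw [cmDensity_mul_exp]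
  rw [integral_mul_const, h.integral_exp_inner, ← Real.exp_add]
  have h1 : ⟪C v, u⟫ = ⟪C u, v⟫ := by
    rw [h.isPositive.inner_left_eq_inner_right, real_inner_comm]
  simp only [map_add, inner_add_left, inner_add_right, h1]
  ring_nf

omit [CompleteSpace H] in
-- The Gram kernel `exp ⟪C u, v⟫` depends only on `C^{1/2} u` and `C^{1/2} v`, so `L²` convergence
-- of densities follows from convergence of these vectors.
lemma integral_cmDensity_mul_cmDensity (h : IsGaussianMeasure ν m C) (u v : H) :
    Integrable (fun x ↦ cmDensity m C u x * cmDensity m C v x) ν ∧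
      ∫ x, cmDensity m C u x * cmDensity m C v x ∂ν = Real.exp ⟪C u, v⟫ := by
  have h1 : ∀ x, cmDensity m C v x = Real.exp (⟪v, x⟫ + (- ⟪m, v⟫ - ⟪C v, v⟫ / 2)) := fun x ↦ by
    rw [cmDensity]; ring_nf
  simp_rw [h1]
  refine ⟨integrable_cmDensity_mul_exp h _ _ _, ?_⟩
  rw [integral_cmDensity_mul_exp h, inner_add_left]
  ring_nf

omit [CompleteSpace H] in
lemma memLp_cmDensity (h : IsGaussianMeasure ν m C) (u : H) : MemLp (cmDensity m C u) 2 ν := by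
  rw [memLp_two_iff_integrable_sq (measurable_cmDensity u).aestronglyMeasurable]
  simpa [pow_two] using (integral_cmDensity_mul_cmDensity h u u).1

omit [CompleteSpace H] in
lemma memLp_exp_inner (h : IsGaussianMeasure ν m C) (u : H) :
    MemLp (fun x ↦ Real.exp ⟪u, x⟫) 2 ν := by
  have hm : Measurable fun x ↦ Real.exp ⟪u, x⟫ := by fun_prop
  rw [memLp_two_iff_integrable_sq hm.aestronglyMeasurable]
  have := h.integrable_exp_inner ((2 : ℝ) • u)
  refine this.congr (ae_of_all _ fun x ↦ ?_)
  dsimp only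
  rw [real_inner_smul_left, ← Real.exp_nat_mul]
  norm_num

/-- A square-integrable density with the exponential moments of `N(m', C)` is a density of
`N(m', C)`. -/
lemma isGaussianMeasure_withDensity (h : IsGaussianMeasure ν m C) {f : H → ℝ}
    (hf : MemLp f 2 ν) (hf0 : 0 ≤ᵐ[ν] f)
    (hexp : ∀ w, ∫ x, f x * Real.exp ⟪w, x⟫ ∂ν = Real.exp (⟪m', w⟫ + ⟪C w, w⟫ / 2)) :
    IsGaussianMeasure (ν.withDensity fun x ↦ ENNReal.ofReal (f x)) m' C := by
  have := h.isProbabilityMeasure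
  have hfi : Integrable f ν := hf.integrable one_le_two
  have : IsFiniteMeasure (ν.withDensity fun x ↦ ENNReal.ofReal (f x)) :=
    isFiniteMeasure_withDensity_ofReal hfi.2
  refine isGaussianMeasure_of_integral_exp_inner h.isPositive fun w ↦ ?_
  rw [integral_withDensity_eq_integral_toReal_smul₀ hfi.aemeasurable.ennreal_ofReal
    (ae_of_all _ fun _ ↦ ENNReal.ofReal_lt_top), ← hexp]
  refine integral_congr_ae (hf0.mono fun x hx ↦ ?_)
  simp only [smul_eq_mul, ENNReal.toReal_ofReal hx]

lemma klDiv_withDensity_ofReal {α : Type*} [MeasurableSpace α] {ν : Measure α}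
    [IsFiniteMeasure ν] {f : α → ℝ} (hf : Integrable f ν) (hf0 : 0 ≤ᵐ[ν] f) :
    klDiv (ν.withDensity fun x ↦ ENNReal.ofReal (f x)) ν =
      ∫⁻ x, ENNReal.ofReal (klFun (f x)) ∂ν := by
  have : IsFiniteMeasure (ν.withDensity fun x ↦ ENNReal.ofReal (f x)) :=
    isFiniteMeasure_withDensity_ofReal hf.2
  rw [klDiv_eq_lintegral_klFun_of_ac (withDensity_absolutelyContinuous _ _)]
  refine lintegral_congr_ae ?_
  filter_upwards [Measure.rnDeriv_withDensity₀ ν hf.aemeasurable.ennreal_ofReal, hf0] with x hx h0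
  rw [hx, ENNReal.toReal_ofReal h0]

/-- The log-density is affine in `x`, so only its mean under the shifted measure `N(m + C u, C)` is
needed. -/
lemma lintegral_klFun_cmDensity (h : IsGaussianMeasure ν m C) (u : H) :
    ∫⁻ x, ENNReal.ofReal (klFun (cmDensity m C u x)) ∂ν = ENNReal.ofReal (⟪C u, u⟫ / 2) := by
  have := h.isProbabilityMeasure
  have hf := memLp_cmDensity h u
  have hfi : Integrable (cmDensity m C u) ν := hf.integrable one_le_two
  have hG : IsGaussianMeasure (ν.withDensity fun x ↦ ENNReal.ofReal (cmDensity m C u x))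
      (m + C u) C :=
    isGaussianMeasure_withDensity h hf (ae_of_all _ fun x ↦ (cmDensity_pos u x).le) fun w ↦ by
      simpa using integral_cmDensity_mul_exp h u w 0
  have hone : ∫ x, cmDensity m C u x ∂ν = 1 := by
    simpa using integral_cmDensity_mul_exp h u 0 0
  have hmeas : Measurable fun x ↦ ENNReal.ofReal (cmDensity m C u x) := by fun_prop
  have hlt : ∀ᵐ x ∂ν, ENNReal.ofReal (cmDensity m C u x) < ∞ :=
    ae_of_all _ fun _ ↦ ENNReal.ofReal_lt_top
  have hint : Integrable (fun x ↦ cmDensity m C u x * ⟪u, x⟫) ν := by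
    have := (integrable_withDensity_iff_integrable_smul' hmeas hlt).1 (hG.integrable_inner u)
    simpa [ENNReal.toReal_ofReal (cmDensity_pos u _).le] using this
  have hmean : ∫ x, cmDensity m C u x * ⟪u, x⟫ ∂ν = ⟪m + C u, u⟫ := by
    rw [← hG.mean u, integral_withDensity_eq_integral_toReal_smul hmeas hlt]
    simp [ENNReal.toReal_ofReal (cmDensity_pos u _).le]
  have hkl : ∀ x, klFun (cmDensity m C u x) = cmDensity m C u x * ⟪u, x⟫
      - (⟪m, u⟫ + ⟪C u, u⟫ / 2 + 1) * cmDensity m C u x + 1 := fun x ↦ by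
    rw [klFun_apply]
    nth_rw 2 [cmDensity]
    rw [Real.log_exp]
    ring
  have hint2 : Integrable (fun x ↦ cmDensity m C u x * ⟪u, x⟫
      - (⟪m, u⟫ + ⟪C u, u⟫ / 2 + 1) * cmDensity m C u x) ν := hint.sub (hfi.const_mul _)
  rw [← ofReal_integral_eq_lintegral_ofReal _
    (ae_of_all _ fun x ↦ klFun_nonneg (cmDensity_pos u x).le)]
  · simp_rw [hkl]
    rw [integral_add hint2 (integrable_const _), integral_sub hint (hfi.const_mul _),
      integral_const_mul, hmean, hone, inner_add_left]
    simp only [integral_const, probReal_univ, smul_eq_mul]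
    ring_nf
  · simp_rw [hkl]
    exact hint2.add (integrable_const _)

/-- Along a sequence `u n` for which `C^{1/2} (u n)` converges, the densities of the shifts by
`C (u n)` converge in `L²`. -/
lemma exists_tendsto_cmDensity (h : IsGaussianMeasure ν m C) {u : ℕ → H} {y : H}
    (hu : Tendsto (fun n ↦ posSqrt C (u n)) atTop (𝓝 y)) :
    ∃ F : Lp ℝ 2 ν, Tendsto (fun n ↦ (memLp_cmDensity h (u n)).toLp) atTop (𝓝 F) := by
  have hC := h.isPositive
  have hinner : ∀ v w : H, ⟪(memLp_cmDensity h v).toLp, (memLp_cmDensity h w).toLp⟫ =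
      Real.exp ⟪posSqrt C v, posSqrt C w⟫ := fun v w ↦ by
    rw [inner_posSqrt hC, posSqrt_posSqrt_apply hC, ← hC.inner_left_eq_inner_right,
      ← (integral_cmDensity_mul_cmDensity h v w).2, L2.inner_def]
    refine integral_congr_ae ?_
    filter_upwards [(memLp_cmDensity h v).coeFn_toLp, (memLp_cmDensity h w).coeFn_toLp]
      with x h1 h2
    rw [h1, h2, RCLike.inner_apply, conj_trivial, mul_comm]
  refine cauchySeq_tendsto_of_complete ?_
  rw [cauchySeq_iff_tendsto_dist_atTop_0]
  have hd : ∀ n : ℕ × ℕ, dist (memLp_cmDensity h (u n.1)).toLp (memLp_cmDensity h (u n.2)).toLp =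
      √(Real.exp (‖posSqrt C (u n.1)‖ ^ 2)
        - 2 * Real.exp ⟪posSqrt C (u n.1), posSqrt C (u n.2)⟫
        + Real.exp (‖posSqrt C (u n.2)‖ ^ 2)) := fun n ↦ by
    rw [dist_eq_norm, ← Real.sqrt_sq (norm_nonneg (_ - _)), norm_sub_sq_real,
      ← real_inner_self_eq_norm_sq, ← real_inner_self_eq_norm_sq, hinner, hinner, hinner,
      real_inner_self_eq_norm_sq, real_inner_self_eq_norm_sq]
  simp_rw [hd]
  have h1 : Tendsto (fun n : ℕ × ℕ ↦ posSqrt C (u n.1)) atTop (𝓝 y) := by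
    rw [← prod_atTop_atTop_eq]; exact hu.comp tendsto_fst
  have h2 : Tendsto (fun n : ℕ × ℕ ↦ posSqrt C (u n.2)) atTop (𝓝 y) := by
    rw [← prod_atTop_atTop_eq]; exact hu.comp tendsto_snd
  have hlim := (((Real.continuous_exp.tendsto _).comp (h1.norm.pow 2)).sub
    (((Real.continuous_exp.tendsto _).comp (h1.inner h2)).const_mul 2)).add
    ((Real.continuous_exp.tendsto _).comp (h2.norm.pow 2))
  have hlim' := (Real.continuous_sqrt.tendsto _).comp hlim
  rw [real_inner_self_eq_norm_sq] at hlim'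
  convert! hlim' using 2
  rw [eq_comm, Real.sqrt_eq_zero']
  linarith

variable [SecondCountableTopology H]

/-- The entropy bound in the Cameron-Martin theorem. -/
lemma klDiv_le_of_mem_cameronMartin (hμ : IsGaussianMeasure μ m' C)
    (hν : IsGaussianMeasure ν m C) (hmem : m' - m ∈ cameronMartin C) :
    klDiv μ ν ≤ ENNReal.ofReal (1 / 2 * ‖invSqrt C (m' - m)‖ ^ 2) := by
  have := hν.isProbabilityMeasure
  have hC := hν.isPositive
  set y := invSqrt C (m' - m)
  have hy : posSqrt C y = m' - m := (invSqrt_spec hmem).2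
  obtain ⟨v, hv, hlim⟩ := mem_closure_iff_seq_limit.1 (invSqrt_mem_closure_range hC hmem)
  choose u hu using hv
  have hu' : Tendsto (fun n ↦ posSqrt C (u n)) atTop (𝓝 y) := by simpa only [hu] using hlim
  obtain ⟨F, hF⟩ := exists_tendsto_cmDensity hν hu'
  -- Almost everywhere convergence along a subsequence gives both `F ≥ 0` and the pointwise limit
  -- for Fatou.
  obtain ⟨ns, hns, hae⟩ := (tendstoInMeasure_of_tendsto_Lp hF).exists_seq_tendsto_ae
  have hae' : ∀ᵐ x ∂ν, Tendsto (fun i ↦ cmDensity m C (u (ns i)) x) atTop (𝓝 (F x)) := by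
    filter_upwards [hae, ae_all_iff.2 fun i ↦ (memLp_cmDensity hν (u (ns i))).coeFn_toLp]
      with x h1 h2
    exact h1.congr h2
  have hF0 : 0 ≤ᵐ[ν] F := hae'.mono fun x hx ↦ ge_of_tendsto' hx fun i ↦ (cmDensity_pos _ x).le
  -- Exponentials lie in `L²(ν)`, so pairing with them passes to the limit and identifies `F` as the
  -- density of `μ`.
  have hexp : ∀ w, ∫ x, F x * Real.exp ⟪w, x⟫ ∂ν = Real.exp (⟪m', w⟫ + ⟪C w, w⟫ / 2) := by
    intro w
    have hpair : ∀ G : Lp ℝ 2 ν, ⟪G, (memLp_exp_inner hν w).toLp⟫ =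
        ∫ x, G x * Real.exp ⟪w, x⟫ ∂ν := fun G ↦ by
      rw [L2.inner_def]
      refine integral_congr_ae ?_
      filter_upwards [(memLp_exp_inner hν w).coeFn_toLp] with x hx
      rw [hx, RCLike.inner_apply, conj_trivial, mul_comm]
    have h1 : Tendsto (fun n ↦ ⟪(memLp_cmDensity hν (u n)).toLp, (memLp_exp_inner hν w).toLp⟫)
        atTop (𝓝 ⟪F, (memLp_exp_inner hν w).toLp⟫) := hF.inner tendsto_const_nhds
    rw [← hpair]
    refine tendsto_nhds_unique h1 ?_
    have h2 : ∀ n, ⟪(memLp_cmDensity hν (u n)).toLp, (memLp_exp_inner hν w).toLp⟫ =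
        Real.exp (⟪m + posSqrt C (posSqrt C (u n)), w⟫ + ⟪C w, w⟫ / 2) := fun n ↦ by
      rw [hpair, posSqrt_posSqrt_apply hC]
      have := integral_cmDensity_mul_exp hν (u n) w 0
      simp only [add_zero] at this
      rw [← this]
      refine integral_congr_ae ?_
      filter_upwards [(memLp_cmDensity hν (u n)).coeFn_toLp] with x hx
      rw [hx]
    simp_rw [h2]
    refine (Real.continuous_exp.tendsto _).comp (Tendsto.add_const _ ?_)
    have h3 : m' = m + posSqrt C y := by rw [hy]; abel
    rw [h3]
    exact ((((posSqrt C).continuous.tendsto y).comp hu').const_add m).inner tendsto_const_nhds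
  have hFm : MemLp F 2 ν := Lp.memLp F
  have hμeq : μ = ν.withDensity fun x ↦ ENNReal.ofReal (F x) :=
    hμ.eq (isGaussianMeasure_withDensity hν hFm hF0 hexp)
  rw [hμeq, klDiv_withDensity_ofReal (hFm.integrable one_le_two) hF0]
  calc ∫⁻ x, ENNReal.ofReal (klFun (F x)) ∂ν
      = ∫⁻ x, liminf (fun i ↦ ENNReal.ofReal (klFun (cmDensity m C (u (ns i)) x))) atTop ∂ν := by
        refine lintegral_congr_ae (hae'.mono fun x hx ↦ ?_)
        exact (((ENNReal.continuous_ofReal.comp continuous_klFun).tendsto _).comp hx).liminf_eq.symm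
    _ ≤ liminf (fun i ↦ ∫⁻ x, ENNReal.ofReal (klFun (cmDensity m C (u (ns i)) x)) ∂ν) atTop :=
        lintegral_liminf_le fun i ↦ by fun_prop
    _ = ENNReal.ofReal (1 / 2 * ‖y‖ ^ 2) := by
        simp_rw [lintegral_klFun_cmDensity hν, inner_apply_eq_norm_posSqrt_sq hC]
        have h1 : Tendsto (fun i ↦ ‖posSqrt C (u (ns i))‖ ^ 2 / 2) atTop (𝓝 (‖y‖ ^ 2 / 2)) :=
          ((hu'.comp hns.tendsto_atTop).norm.pow 2).div_const 2
        rw [(ENNReal.tendsto_ofReal h1).liminf_eq]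
        ring_nf

/-- The Kullback-Leibler divergence of two Gaussian measures with the same covariance operator,
including the singular case. -/
theorem klDiv_eq_invSqrtNormSq (hμ : IsGaussianMeasure μ m' C) (hν : IsGaussianMeasure ν m C) :
    klDiv μ ν = ENNReal.ofReal (1 / 2) * invSqrtNormSq C (m' - m) := by
  have := hμ.isProbabilityMeasure
  have := hν.isProbabilityMeasure
  have hC := hν.isPositive
  apply le_antisymm
  · by_cases hmem : m' - m ∈ cameronMartin C
    · rw [invSqrtNormSq, if_pos hmem, ← ENNReal.ofReal_mul (by norm_num)]
      exact klDiv_le_of_mem_cameronMartin hμ hν hmem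
    · rw [invSqrtNormSq, if_neg hmem, ENNReal.mul_top (by simp)]
      exact le_top
  -- This direction also settles the singular case, where the supremum is `∞`.
  · rw [invSqrtNormSq_eq_iSup hC, ENNReal.mul_iSup]
    refine iSup_le fun u ↦ ?_
    rw [← ENNReal.ofReal_mul (by norm_num)]
    refine le_of_eq_of_le ?_ (ofReal_integral_sub_log_le_klDiv (hμ.integrable_inner u)
      (hν.integrable_exp_inner u))
    rw [hμ.mean, hν.integral_exp_inner, Real.log_exp, inner_sub_left]
    ring_nf

end CameronMartin

/-! ### Signs and bounds for the variance schedule -/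

section Schedule

variable {β : ℕ → ℝ} {T : ℕ}

lemma alphaBar_succ (β : ℕ → ℝ) (t : ℕ) :
    alphaBar β (t + 1) = alphaBar β t * (1 - β (t + 1)) :=
  Finset.prod_Icc_succ_top (Nat.le_add_left 1 t) _

lemma alphaBar_zero (β : ℕ → ℝ) : alphaBar β 0 = 1 := by simp [alphaBar]

lemma alphaBar_pos (hβ : ∀ t ∈ Finset.Icc 1 T, 0 < β t ∧ β t < 1) {t : ℕ} (ht : t ≤ T) :
    0 < alphaBar β t :=
  Finset.prod_pos fun i hi ↦ by
    rw [Finset.mem_Icc] at hi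
    linarith [(hβ i (Finset.mem_Icc.2 ⟨hi.1, hi.2.trans ht⟩)).2]

lemma alphaBar_le_one (hβ : ∀ t ∈ Finset.Icc 1 T, 0 < β t ∧ β t < 1) {t : ℕ} (ht : t ≤ T) :
    alphaBar β t ≤ 1 :=
  Finset.prod_le_one (fun i hi ↦ by
    rw [Finset.mem_Icc] at hi
    linarith [(hβ i (Finset.mem_Icc.2 ⟨hi.1, hi.2.trans ht⟩)).2]) fun i hi ↦ by
    rw [Finset.mem_Icc] at hi
    linarith [(hβ i (Finset.mem_Icc.2 ⟨hi.1, hi.2.trans ht⟩)).1]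

lemma alphaBar_lt_one (hβ : ∀ t ∈ Finset.Icc 1 T, 0 < β t ∧ β t < 1) {t : ℕ} (h1 : 1 ≤ t)
    (ht : t ≤ T) : alphaBar β t < 1 := by
  obtain ⟨s, rfl⟩ := Nat.exists_eq_add_of_le' h1
  rw [alphaBar_succ]
  have h2 := hβ (s + 1) (Finset.mem_Icc.2 ⟨h1, ht⟩)
  have h3 := alphaBar_le_one hβ (t := s) (by omega)
  have h4 := alphaBar_pos hβ (t := s) (by omega)
  nlinarith

lemma betaTilde_nonneg (hβ : ∀ t ∈ Finset.Icc 1 T, 0 < β t ∧ β t < 1) {t : ℕ} (h1 : 1 ≤ t)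
    (ht : t ≤ T) : 0 ≤ betaTilde β t :=
  mul_nonneg (div_nonneg (sub_nonneg.2 (alphaBar_le_one hβ (by omega)))
    (sub_nonneg.2 (alphaBar_le_one hβ ht))) (hβ t (Finset.mem_Icc.2 ⟨h1, ht⟩)).1.le

lemma betaTilde_pos (hβ : ∀ t ∈ Finset.Icc 1 T, 0 < β t ∧ β t < 1) {t : ℕ} (h2 : 2 ≤ t)
    (ht : t ≤ T) : 0 < betaTilde β t :=
  mul_pos (div_pos (sub_pos.2 (alphaBar_lt_one hβ (by omega) (by omega)))
    (sub_pos.2 (alphaBar_lt_one hβ (by omega) ht))) (hβ t (Finset.mem_Icc.2 ⟨by omega, ht⟩)).1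

end Schedule

/-! ### Closed form of the forward chain and the difference of means -/

section Chain

variable {H : Type*} [NormedAddCommGroup H] [InnerProductSpace ℝ H] {β : ℕ → ℝ} {T : ℕ}

/-- Variances propagate by `(1 - β)(1 - ᾱ_t) + β = 1 - ᾱ_{t+1}`, where `β = β_{t+1}`. The
coefficients are chosen before the input and the noises, so the combined noise is a fixed linear
function of the `ξ i`. -/
lemma exists_forward_eq (hβ : ∀ t ∈ Finset.Icc 1 T, 0 < β t ∧ β t < 1) (A : H →L[ℝ] H) :
    ∀ t ≤ T, ∃ c : ℕ → ℝ, ∑ i ∈ Finset.Icc 1 t, c i ^ 2 = 1 - alphaBar β t ∧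
      ∀ (v : H) (ξ : ℕ → H), forward A β v ξ t =
        √(alphaBar β t) • A v + A (∑ i ∈ Finset.Icc 1 t, c i • ξ i) := by
  intro t
  induction t with
  | zero => exact fun _ ↦ ⟨0, by simp [alphaBar_zero], fun v ξ ↦ by simp [forward, alphaBar_zero]⟩
  | succ t ih =>
    intro ht
    obtain ⟨c, hc, hfwd⟩ := ih (by omega)
    have hb := hβ (t + 1) (Finset.mem_Icc.2 ⟨by omega, ht⟩)
    have hb' : 0 ≤ 1 - β (t + 1) := by linarith
    have hne : ∀ i ∈ Finset.Icc 1 t, i ≠ t + 1 := fun i hi ↦ by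
      rw [Finset.mem_Icc] at hi; omega
    refine ⟨fun i ↦ if i = t + 1 then √(β (t + 1)) else √(1 - β (t + 1)) * c i, ?_, fun v ξ ↦ ?_⟩
    · dsimp only
      rw [Finset.sum_Icc_succ_top (by omega), if_pos rfl, Real.sq_sqrt hb.1.le]
      rw [Finset.sum_congr rfl (g := fun i ↦ (1 - β (t + 1)) * c i ^ 2) fun i hi ↦ by
        rw [if_neg (hne i hi), mul_pow, Real.sq_sqrt hb'], ← Finset.mul_sum, hc, alphaBar_succ]
      ring
    · have hsum : ∑ i ∈ Finset.Icc 1 t,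
          (if i = t + 1 then √(β (t + 1)) else √(1 - β (t + 1)) * c i) • ξ i =
          √(1 - β (t + 1)) • ∑ i ∈ Finset.Icc 1 t, c i • ξ i := by
        rw [Finset.smul_sum]
        exact Finset.sum_congr rfl fun i hi ↦ by rw [if_neg (hne i hi), mul_smul]
      dsimp only
      rw [forward, hfwd, Finset.sum_Icc_succ_top (by omega), if_pos rfl, hsum, alphaBar_succ,
        Real.sqrt_mul (alphaBar_pos hβ (by omega)).le, map_add, map_smul, map_smul]
      module

/-- At this `u_t` the posterior mean equals `modelMean` with `A x` in place of `z`, so the `A v`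
terms cancel. -/
lemma posteriorMean_sub_modelMean (hβ : ∀ t ∈ Finset.Icc 1 T, 0 < β t ∧ β t < 1)
    (A : H →L[ℝ] H) {t : ℕ} (h1 : 1 ≤ t) (ht : t ≤ T) (v x z : H) :
    posteriorMean A β t (√(alphaBar β t) • A v + √(1 - alphaBar β t) • A x) v -
      modelMean β t (√(alphaBar β t) • A v + √(1 - alphaBar β t) • A x) z =
    (-(β t / (√(1 - β t) * √(1 - alphaBar β t)))) • (A x - z) := by
  have ha := alphaBar_pos hβ (t := t - 1) (by omega)
  have hlt := alphaBar_lt_one hβ h1 ht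
  have hb := hβ t (Finset.mem_Icc.2 ⟨h1, ht⟩)
  have hsucc : alphaBar β t = alphaBar β (t - 1) * (1 - β t) := by
    obtain ⟨s, rfl⟩ := Nat.exists_eq_add_of_le' h1
    exact alphaBar_succ β s
  have hs2 : √(1 - alphaBar β t) ^ 2 = 1 - alphaBar β t := Real.sq_sqrt (by linarith)
  have hb2 : √(1 - β t) ^ 2 = 1 - β t := Real.sq_sqrt (by linarith)
  have ha2 : √(alphaBar β (t - 1)) ^ 2 = alphaBar β (t - 1) := Real.sq_sqrt ha.le
  have hab : √(alphaBar β t) = √(alphaBar β (t - 1)) * √(1 - β t) := by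
    rw [hsucc, Real.sqrt_mul ha.le]
  have hs0 : √(1 - alphaBar β t) ≠ 0 := (Real.sqrt_pos.2 (by linarith)).ne'
  have hb0 : √(1 - β t) ≠ 0 := (Real.sqrt_pos.2 (by linarith)).ne'
  rw [posteriorMean, modelMean, hab]
  set a := √(alphaBar β (t - 1))
  set b := √(1 - β t)
  set s := √(1 - alphaBar β t)
  have hβb : β t = 1 - b ^ 2 := by linarith
  have hsab : s ^ 2 = 1 - a ^ 2 * b ^ 2 := by rw [hs2, hsucc, ha2, hb2]
  rw [← hs2, ← ha2, hβb]
  match_scalars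
  · field_simp
    rw [hsab]; ring
  · field_simp
    rw [hsab]; ring
  · field_simp

end Chain

/-! ### From divergence terms to noise-prediction errors -/

section Loss

variable {H : Type*} [NormedAddCommGroup H] [InnerProductSpace ℝ H] [CompleteSpace H]
  [SecondCountableTopology H] [MeasurableSpace H] [BorelSpace H] {E Θ : Type*}
  {β : ℕ → ℝ} {T : ℕ} {C : H →L[ℝ] H}

/-- The case `c = 0` is included because `β̃_1 = 0`. -/
lemma isGaussianMeasure_gaussianMeasure_smul (h : IsGaussianMeasure (gaussianMeasure 0 C) 0 C)
    (m : H) {c : ℝ} (hc : 0 ≤ c) : IsGaussianMeasure (gaussianMeasure m (c • C)) m (c • C) := by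
  have h1 := h.map_const_add_smul m (Real.sq_sqrt hc)
  rwa [h1.gaussianMeasure_eq]

/-- The Kullback-Leibler terms of the variational bound are weighted noise-prediction errors. -/
lemma klStep_eq (hβ : ∀ t ∈ Finset.Icc 1 T, 0 < β t ∧ β t < 1)
    (h : IsGaussianMeasure (gaussianMeasure 0 C) 0 C) (A : H →L[ℝ] H)
    (ξθ : Θ → H → E → ℕ → H) (θ : Θ) {t : ℕ} (h2 : 2 ≤ t) (ht : t ≤ T) (v x : H) (e : E) :
    klStep A C β ξθ θ t (√(alphaBar β t) • A v + √(1 - alphaBar β t) • A x) v e =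
      ENNReal.ofReal (lossWeight β t) * invSqrtNormSq C
        (A x - ξθ θ (√(alphaBar β t) • A v + √(1 - alphaBar β t) • A x) e t) := by
  have hbt := betaTilde_pos hβ h2 ht
  have hb := hβ t (Finset.mem_Icc.2 ⟨by omega, ht⟩)
  have hlt := alphaBar_lt_one hβ (by omega) ht
  have hs0 : √(1 - alphaBar β t) ≠ 0 := (Real.sqrt_pos.2 (by linarith)).ne'
  have hb0 : √(1 - β t) ≠ 0 := (Real.sqrt_pos.2 (by linarith)).ne'
  rw [klStep, posterior, reverse, klDiv_eq_invSqrtNormSq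
    (isGaussianMeasure_gaussianMeasure_smul h _ hbt.le)
    (isGaussianMeasure_gaussianMeasure_smul h _ hbt.le),
    posteriorMean_sub_modelMean hβ A (by omega) ht,
    invSqrtNormSq_smul_smul h.isPositive hbt
      (neg_ne_zero.2 (div_ne_zero hb.1.ne' (mul_ne_zero hb0 hs0))),
    ← mul_assoc, ← ENNReal.ofReal_mul (by norm_num)]
  congr 2
  rw [lossWeight, neg_sq, div_pow, mul_pow, Real.sq_sqrt (by linarith), Real.sq_sqrt (by linarith)]
  have h3 : 1 - β t ≠ 0 := by linarith
  have h4 : 1 - alphaBar β t ≠ 0 := by linarith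
  field_simp

/-- At each step the forward chain has the form `√ᾱ_t A u₀ + √(1 - ᾱ_t) A ζ`, with `ζ ∼ N(0, C)`
independent of the data. -/
lemma exists_forward_noise {Ω : Type*} [MeasurableSpace Ω] {P : Measure Ω} [IsProbabilityMeasure P]
    {F : Type*} [MeasurableSpace F] {Z : Ω → F}
    (hβ : ∀ t ∈ Finset.Icc 1 T, 0 < β t ∧ β t < 1) (A : H →L[ℝ] H) {ξ : ℕ → Ω → H}
    (hξ : ∀ t, HasLaw (ξ t) (gaussianMeasure 0 C) P)
    (h : IsGaussianMeasure (gaussianMeasure 0 C) 0 C) (hindep : iIndepFun ξ P)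
    (hindep' : IndepFun Z (fun ω t ↦ ξ t ω) P) {t : ℕ} (h1 : 1 ≤ t) (ht : t ≤ T) :
    ∃ ζ : Ω → H, HasLaw ζ (gaussianMeasure 0 C) P ∧ IndepFun Z ζ P ∧
      ∀ (v : H) (ω : Ω), forward A β v (fun s ↦ ξ s ω) t =
        √(alphaBar β t) • A v + √(1 - alphaBar β t) • A (ζ ω) := by
  obtain ⟨c, hc, hfwd⟩ := exists_forward_eq hβ A t ht
  have hlt := alphaBar_lt_one hβ h1 ht
  set s := √(1 - alphaBar β t)
  have hs0 : s ≠ 0 := (Real.sqrt_pos.2 (by linarith)).ne'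
  have hs2 : s ^ 2 = 1 - alphaBar β t := Real.sq_sqrt (by linarith)
  have hm : ∀ t, AEMeasurable (ξ t) P := fun t ↦ (hξ t).aemeasurable
  -- Dividing by `s = √(1 - ᾱ_t)` makes the squared coefficients sum to 1.
  refine ⟨fun ω ↦ ∑ i ∈ Finset.Icc 1 t, (c i / s) • ξ i ω, ⟨?_, ?_⟩, ?_, fun v ω ↦ ?_⟩
  · exact Finset.aemeasurable_fun_sum (Finset.Icc 1 t) fun i _ ↦ (hm i).const_smul (c i / s)
  · have h2 := isGaussianMeasure_map_sum_smul (C := C) hm (fun t ↦ by rwa [(hξ t).map_eq]) hindep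
      (fun i ↦ c i / s) (Finset.Icc 1 t)
    simp_rw [div_pow] at h2
    rw [← Finset.sum_div, hc, hs2, div_self (by linarith), one_smul] at h2
    exact h2.eq h
  · have hψ : Measurable fun x : ℕ → H ↦ ∑ i ∈ Finset.Icc 1 t, (c i / s) • x i := by fun_prop
    exact hindep'.comp measurable_id hψ
  · rw [hfwd, ← map_smul A s, Finset.smul_sum]
    simp_rw [smul_smul, mul_div_cancel₀ _ hs0]

/-- The integrand of the noise-prediction error is measurable. -/
lemma measurable_noiseIntegrand [MeasurableSpace E] (hC : C.IsPositive) (A : H →L[ℝ] H)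
    {f : H → E → H} (hf : Measurable fun p : H × E ↦ f p.1 p.2) (a b : ℝ) :
    Measurable fun p : (H × E) × H ↦
      invSqrtNormSq C (A p.2 - f (a • A p.1.1 + b • A p.2) p.1.2) := by
  refine (measurable_invSqrtNormSq hC).comp ?_
  have h1 : Measurable fun p : (H × E) × H ↦ (a • A p.1.1 + b • A p.2, p.1.2) := by fun_prop
  exact (by fun_prop : Measurable fun p : (H × E) × H ↦ A p.2).sub (hf.comp h1)

/-- The expected Kullback-Leibler terms. -/
lemma lintegral_klStep {Ω : Type*} [MeasurableSpace Ω] {P : Measure Ω} [IsProbabilityMeasure P]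
    [MeasurableSpace E] (hβ : ∀ t ∈ Finset.Icc 1 T, 0 < β t ∧ β t < 1) (A : H →L[ℝ] H)
    {D : Measure (H × E)} {u₀ : Ω → H} {e : Ω → E} {ξ : ℕ → Ω → H}
    (hdata : HasLaw (fun ω ↦ (u₀ ω, e ω)) D P)
    (hξ : ∀ t, HasLaw (ξ t) (gaussianMeasure 0 C) P)
    (h : IsGaussianMeasure (gaussianMeasure 0 C) 0 C) (hindep : iIndepFun ξ P)
    (hindep' : IndepFun (fun ω ↦ (u₀ ω, e ω)) (fun ω t ↦ ξ t ω) P)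
    (ξθ : Θ → H → E → ℕ → H) (θ : Θ) {t : ℕ} (h2 : 2 ≤ t) (ht : t ≤ T)
    (hξθ : Measurable fun p : H × E ↦ ξθ θ p.1 p.2 t) :
    AEMeasurable (fun ω ↦
      klStep A C β ξθ θ t (forward A β (u₀ ω) (fun s ↦ ξ s ω) t) (u₀ ω) (e ω)) P ∧
    ∫⁻ ω, klStep A C β ξθ θ t (forward A β (u₀ ω) (fun s ↦ ξ s ω) t) (u₀ ω) (e ω) ∂P =
      ENNReal.ofReal (lossWeight β t) * noiseError D A C β ξθ θ t := by
  obtain ⟨ζ, hζ, hind, hfwd⟩ := exists_forward_noise hβ A hξ h hindep hindep' (by omega) ht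
  have := h.isProbabilityMeasure
  have hD : IsProbabilityMeasure D := by
    rw [← hdata.map_eq]; exact Measure.isProbabilityMeasure_map hdata.aemeasurable
  have hpair : AEMeasurable (fun ω ↦ ((u₀ ω, e ω), ζ ω)) P :=
    hdata.aemeasurable.prodMk hζ.aemeasurable
  -- Independence makes the joint law a product, and Tonelli then gives the iterated integral of
  -- `noiseError`.
  have hlaw : P.map (fun ω ↦ ((u₀ ω, e ω), ζ ω)) = D.prod (gaussianMeasure 0 C) := by
    rw [(indepFun_iff_map_prod_eq_prod_map_map hdata.aemeasurable hζ.aemeasurable).1 hind,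
      hdata.map_eq, hζ.map_eq]
  have hG := measurable_noiseIntegrand h.isPositive A (f := fun x c ↦ ξθ θ x c t) hξθ
    (√(alphaBar β t)) (√(1 - alphaBar β t))
  simp_rw [hfwd, klStep_eq hβ h A ξθ θ h2 ht]
  refine ⟨(hG.const_mul _).comp_aemeasurable hpair, ?_⟩
  have hG' : AEMeasurable (fun ω ↦ invSqrtNormSq C (A (ζ ω) -
      ξθ θ (√(alphaBar β t) • A (u₀ ω) + √(1 - alphaBar β t) • A (ζ ω)) (e ω) t)) P :=
    hG.comp_aemeasurable hpair
  rw [lintegral_const_mul'' _ hG']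
  congr 1
  rw [noiseError, ← lintegral_prod _ hG.aemeasurable, ← hlaw,
    lintegral_map' hG.aemeasurable hpair]

end Loss

/-! ### Minimizers and the main theorem -/

section Argmin

variable {Θ : Type*}

lemma argmin_congr {α γ : Type*} [Preorder α] [Preorder γ] {f : Θ → α} {g : Θ → γ}
    (h : ∀ θ θ', f θ ≤ f θ' ↔ g θ ≤ g θ') : argmin f = argmin g := by
  ext θ
  exact forall_congr' fun θ' ↦ h θ θ'

end Argmin

end FunDiff

theorem theorem1
    {H : Type*} [NormedAddCommGroup H] [InnerProductSpace ℝ H] [CompleteSpace H]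
    [SecondCountableTopology H] [MeasurableSpace H] [BorelSpace H]
    {E : Type*} [MeasurableSpace E] {Θ : Type*}
    {Ω : Type*} [MeasurableSpace Ω] (P : Measure Ω) [IsProbabilityMeasure P]
    -- variance schedule, covariance and smoothing operators
    (T : ℕ) (hT : 2 ≤ T) (β : ℕ → ℝ) (hβ : ∀ t ∈ Finset.Icc 1 T, 0 < β t ∧ β t < 1)
    (A C : H →L[ℝ] H)
    -- the data `(u₀, e) ∼ D` and the independent noises `ξ_t ∼ N(0, C)`
    (D : Measure (H × E)) (u₀ : Ω → H) (e : Ω → E) (ξ : ℕ → Ω → H)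
    (hdata : HasLaw (fun ω ↦ (u₀ ω, e ω)) D P)
    (hξ : ∀ t, HasLaw (ξ t) (gaussianMeasure 0 C) P)
    (hindep : iIndepFun ξ P)
    (hindep' : IndepFun (fun ω ↦ (u₀ ω, e ω)) (fun ω t ↦ ξ t ω) P)
    -- the noise predictor, the law of `u_T` in the model, and the decoder
    (ξθ : Θ → H → E → ℕ → H)
    (hξθ : ∀ θ, ∀ t ∈ Finset.Icc 2 T, Measurable fun p : H × E ↦ ξθ θ p.1 p.2 t)
    (prior : Measure H) [IsProbabilityMeasure prior]
    (dec : Θ → H → E → Measure H) (ν : Measure H) :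
    -- the Kullback-Leibler divergence under the Cameron-Martin condition
    (∀ θ, ∀ t ∈ Finset.Icc 1 T, ∀ (ut v : H) (c : E),
      posteriorMean A β t ut v - modelMean β t ut (ξθ θ ut c t)
          ∈ cameronMartin (betaTilde β t • C) →
        klDiv (gaussianMeasure (posteriorMean A β t ut v) (betaTilde β t • C))
            (gaussianMeasure (modelMean β t ut (ξθ θ ut c t)) (betaTilde β t • C)) =
          ENNReal.ofReal (1 / 2 * ‖invSqrt (betaTilde β t • C)
            (posteriorMean A β t ut v - modelMean β t ut (ξθ θ ut c t))‖ ^ 2)) ∧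
    -- each Kullback-Leibler term of the bound is a weighted noise-prediction error
    (∀ θ, ∀ t ∈ Finset.Icc 2 T,
      ∫⁻ ω, klStep A C β ξθ θ t (forward A β (u₀ ω) (fun s ↦ ξ s ω) t) (u₀ ω) (e ω) ∂P =
        ENNReal.ofReal (lossWeight β t) * noiseError D A C β ξθ θ t) ∧
    -- the whole bound
    (∀ θ, learningObjective P A C β T prior dec ν ξθ u₀ e ξ θ =
      ((∫⁻ ω, klPrior A C β T prior (u₀ ω) ∂P : ℝ≥0∞) : EReal) +
        expectedNLL P A β dec ν u₀ e ξ θ +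
        (((T - 1 : ℕ) * noiseLoss D A C β T ξθ θ : ℝ≥0∞) : EReal)) ∧
    -- minimizing the bound is minimizing the loss
    (∫⁻ ω, klPrior A C β T prior (u₀ ω) ∂P ≠ ∞ →
      (argmin (learningObjective P A C β T prior dec ν ξθ u₀ e ξ) =
        argmin fun θ ↦ expectedNLL P A β dec ν u₀ e ξ θ +
          (((T - 1 : ℕ) * noiseLoss D A C β T ξθ θ : ℝ≥0∞) : EReal)) ∧
      ((∃ r : ℝ, ∀ θ, expectedNLL P A β dec ν u₀ e ξ θ = (r : EReal)) →
        argmin (learningObjective P A C β T prior dec ν ξθ u₀ e ξ) =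
          argmin (noiseLoss D A C β T ξθ))) := by

  -- As the law of `ξ 0` this measure is not the default zero measure, so `C` is a genuine
  -- covariance operator.
  have hP : IsProbabilityMeasure (gaussianMeasure 0 C) := by
    rw [← (hξ 0).map_eq]; exact Measure.isProbabilityMeasure_map (hξ 0).aemeasurable
  have hC : IsGaussianMeasure (gaussianMeasure 0 C) 0 C :=
    isGaussianMeasure_gaussianMeasure_of_neZero
  have hstep : ∀ θ, ∀ t ∈ Finset.Icc 2 T, _ ∧ _ := fun θ t ht ↦
    lintegral_klStep hβ A hdata hξ hC hindep hindep' ξθ θ (Finset.mem_Icc.1 ht).1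
      (Finset.mem_Icc.1 ht).2 (hξθ θ t ht)
  have hobj : ∀ θ, learningObjective P A C β T prior dec ν ξθ u₀ e ξ θ =
      ((∫⁻ ω, klPrior A C β T prior (u₀ ω) ∂P : ℝ≥0∞) : EReal) +
        (expectedNLL P A β dec ν u₀ e ξ θ +
          (((T - 1 : ℕ) * noiseLoss D A C β T ξθ θ : ℝ≥0∞) : EReal)) := fun θ ↦ by
    have hcard : (Finset.Icc 2 T).card = T - 1 := by rw [Nat.card_Icc]; omega
    have hT1 : ((T - 1 : ℕ) : ℝ≥0∞) ≠ 0 := Nat.cast_ne_zero.2 (by omega)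
    -- Splitting off the second summand needs measurability of the step terms only, not of
    -- `klPrior`. The factor `T - 1` cancels the uniform weight.
    rw [learningObjective, lintegral_add_right' _
      (Finset.aemeasurable_fun_sum _ fun t ht ↦ (hstep θ t ht).1),
      lintegral_finsetSum' _ fun t ht ↦ (hstep θ t ht).1,
      Finset.sum_congr rfl fun t ht ↦ (hstep θ t ht).2, noiseLoss, hcard, ← mul_assoc,
      ENNReal.mul_inv_cancel hT1 (ENNReal.natCast_ne_top _), one_mul, EReal.coe_ennreal_add,
      add_assoc, add_comm (expectedNLL P A β dec ν u₀ e ξ θ)]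
  refine ⟨fun θ t ht ut v c hmem ↦ ?_, fun θ t ht ↦ (hstep θ t ht).2,
    fun θ ↦ (hobj θ).trans (add_assoc _ _ _).symm, fun hfin ↦ ?_⟩
  · rw [Finset.mem_Icc] at ht
    have hbt := betaTilde_nonneg hβ ht.1 ht.2
    rw [klDiv_eq_invSqrtNormSq (isGaussianMeasure_gaussianMeasure_smul hC _ hbt)
      (isGaussianMeasure_gaussianMeasure_smul hC _ hbt), invSqrtNormSq, if_pos hmem,
      ← ENNReal.ofReal_mul (by norm_num)]
  -- Only a real constant can be cancelled from an inequality in `EReal`; this is where finiteness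
  -- of the prior term enters.
  · have hK : ((∫⁻ ω, klPrior A C β T prior (u₀ ω) ∂P : ℝ≥0∞) : EReal) =
        ((∫⁻ ω, klPrior A C β T prior (u₀ ω) ∂P).toReal : EReal) :=
      (EReal.coe_ennreal_toReal hfin).symm
    have h1 : argmin (learningObjective P A C β T prior dec ν ξθ u₀ e ξ) =
        argmin fun θ ↦ expectedNLL P A β dec ν u₀ e ξ θ +
          (((T - 1 : ℕ) * noiseLoss D A C β T ξθ θ : ℝ≥0∞) : EReal) :=
      argmin_congr fun θ θ' ↦ by
        rw [hobj, hobj, hK, (EReal.addLECancellable_coe _).add_le_add_iff_left]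
    refine ⟨h1, fun ⟨r, hr⟩ ↦ h1.trans (argmin_congr fun θ θ' ↦ ?_)⟩
    have hT1 : ((T - 1 : ℕ) : ℝ≥0∞) ≠ 0 := Nat.cast_ne_zero.2 (by omega)
    rw [hr, hr, (EReal.addLECancellable_coe _).add_le_add_iff_left, EReal.coe_ennreal_le_coe_ennreal_iff,
      ENNReal.mul_le_mul_iff_right hT1 (ENNReal.natCast_ne_top _)]
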